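/- For an integer $N\ge 0$ let $H(N)$ be the Hurwitz class number: $H(0)=-1/12$; $H(N)=0$ if $N\equiv 1,2\pmod 4$; and if $N>0$, $N\equiv 0,3\pmod 4$, then $H(N)$ is the number of proper ($\mathrm{SL}_2(\mathbb Z)$-) equivalence classes of positive definite, not necessarily primitive, integral binary quadratic forms $ax^2+bxy+cy^2$ of discriminant $b^2-4ac=-N$, where classes containing a multiple of $x^2+y^2$ or of $x^2+xy+y^2$ are counted with weight $1/2$ or $1/3$, respectively. Put $F(8n+7)=H(8n+7)$ and $F(8n+3)=3H(8n+3)$ for $n\ge 0$, and $F(-1)=0$. For $q\in\mathbb C$ with $|q|<1$ let $$\mathscr F_{4,-1}(q)=\sum_{n=0}^{\infty}F(4n-1)q^n,\qquad J_k=(q^k;q^k)_\infty=\prod_{i=1}^{\infty}(1-q^{ki})\quad(k\ge 1).$$ **Corollary (Hecke–Rogers series of $\mathscr F_{4,-1}$).** For every $q\in\mathbb C$ with $|q|<1$, the products $J_k$, the series $\mathscr F_{4,-1}(q)$ and the double series below converge absolutely, $J_2\neq 0$, and $$\frac{J_1J_4}{J_2}\,\mathscr F_{4,-1}(q)=\sum_{1\le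 j\le n}(-1)^{\,n-1+j(j-1)/2}\;n\;q^{\,n^2-j(j-1)/2},$$ where the sum is over all pairs of integers $(n,j)$ with $1\le j\le n$. -/

import Mathlib

noncomputable section

namespace HurwitzSeries

/-- The integral binary quadratic form `a x² + b x y + c y²`. -/
@[ext]
structure BinForm where
  a : ℤ
  b : ℤ
  c : ℤ

namespace BinForm

/-- The value of the form at `(x, y)`. -/
def eval (f : BinForm) (x y : ℤ) : ℤ := f.a * x ^ 2 + f.b * x * y + f.c * y ^ 2

/-- The discriminant `b² - 4 a c`. -/
def disc (f : BinForm) : ℤ := f.b ^ 2 - 4 * f.a * f.c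

/-- Positive definiteness. -/
def PosDef (f : BinForm) : Prop := ∀ x y : ℤ, (x, y) ≠ (0, 0) → 0 < f.eval x y

/-- Proper equivalence: `f` arises from `g` by a substitution of determinant one. -/
def ProperEquiv (f g : BinForm) : Prop :=
  ∃ γ : Matrix.SpecialLinearGroup (Fin 2) ℤ, ∀ x y : ℤ,
    f.eval x y = g.eval (γ 0 0 * x + γ 0 1 * y) (γ 1 0 * x + γ 1 1 * y)

theorem properEquiv_refl (f : BinForm) : ProperEquiv f f :=
  ⟨1, fun x y => by simp⟩

theorem properEquiv_symm {f g : BinForm} (h : ProperEquiv f g) : ProperEquiv g f := by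
  obtain ⟨γ, hγ⟩ := h
  refine ⟨γ⁻¹, fun x y => ?_⟩
  have hd : γ 0 0 * γ 1 1 - γ 0 1 * γ 1 0 = 1 := by
    rw [← Matrix.det_fin_two]; exact γ.det_coe
  rw [hγ]
  simp only [Matrix.SpecialLinearGroup.SL2_inv_expl, Matrix.cons_val_zero, Matrix.cons_val_one,
    Matrix.cons_val', Matrix.cons_val_fin_one]
  congr 1
  · linear_combination (-x) * hd
  · linear_combination (-y) * hd

theorem properEquiv_trans {f g h : BinForm} (h₁ : ProperEquiv f g) (h₂ : ProperEquiv g h) :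
    ProperEquiv f h := by
  obtain ⟨γ, hγ⟩ := h₁
  obtain ⟨δ, hδ⟩ := h₂
  refine ⟨δ * γ, fun x y => ?_⟩
  rw [hγ, hδ]
  simp only [Matrix.SpecialLinearGroup.coe_mul, Matrix.mul_apply, Fin.sum_univ_two]
  congr 1 <;> ring

end BinForm

/-- The positive definite (not necessarily primitive) forms of discriminant `-N`. -/
def Forms (N : ℕ) : Type := {f : BinForm // f.PosDef ∧ f.disc = -(N : ℤ)}

/-- Proper equivalence on the positive definite forms of discriminant `-N`. -/
instance formsSetoid (N : ℕ) : Setoid (Forms N) where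
  r f g := BinForm.ProperEquiv f.1 g.1
  iseqv :=
    ⟨fun f => BinForm.properEquiv_refl f.1, BinForm.properEquiv_symm, BinForm.properEquiv_trans⟩

/-- The classes of positive definite forms of discriminant `-N`. -/
def FormClasses (N : ℕ) : Type := Quotient (formsSetoid N)

open Classical in
/-- The weight of a class: `1/2` if it contains a multiple of `x² + y²`, `1/3` if it contains a
multiple of `x² + x y + y²`, and `1` otherwise. -/
def classWeight {N : ℕ} (C : FormClasses N) : ℚ :=
  if ∃ f : Forms N, Quotient.mk (formsSetoid N) f = C ∧ ∃ k : ℤ, f.1 = ⟨k, 0, k⟩ then 1 / 2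
  else if ∃ f : Forms N, Quotient.mk (formsSetoid N) f = C ∧ ∃ k : ℤ, f.1 = ⟨k, k, k⟩ then 1 / 3
  else 1

/-- The Hurwitz class number `H(N)`. For `N > 0` there are only finitely many classes, so the
`finsum` is an honest finite sum. -/
def hurwitzH (N : ℕ) : ℚ :=
  if N = 0 then -1 / 12
  else if N % 4 = 1 ∨ N % 4 = 2 then 0
  else ∑ᶠ C : FormClasses N, classWeight C

/-- Kronecker's `F(m)` at the integers `m ≡ 3 (mod 4)`, the only arguments that are used:
`F(8n+7) = H(8n+7)`, `F(8n+3) = 3 H(8n+3)`, and `F(m) = 0` for negative `m`.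
The value is set to `0` at all other `m`. -/
def kroneckerF (m : ℤ) : ℚ :=
  if m < 0 then 0
  else if m % 8 = 7 then hurwitzH m.toNat
  else if m % 8 = 3 then 3 * hurwitzH m.toNat
  else 0

/-- The `n`-th term `F(4n-1) qⁿ` of the series `𝓕_{4,-1}(q)`. -/
def termF4 (q : ℂ) (n : ℕ) : ℂ := ((kroneckerF (4 * (n : ℤ) - 1) : ℚ) : ℂ) * q ^ n

/-- `𝓕_{4,-1}(q) = ∑_{n ≥ 0} F(4n-1) qⁿ`. -/
def seriesF4 (q : ℂ) : ℂ := ∑' n : ℕ, termF4 q n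

/-- `(a; q)_∞ = ∏_{i ≥ 0} (1 - a qⁱ)`. -/
def qPochInf (a q : ℂ) : ℂ := ∏' i : ℕ, (1 - a * q ^ i)

/-- `J_k = (q^k; q^k)_∞`. -/
def J (k : ℕ) (q : ℂ) : ℂ := qPochInf (q ^ k) (q ^ k)

end HurwitzSeries

end

namespace HurwitzSeries

open Filter Topology Finset

/-! Replacing `q` by `-q` removes the signs. Write ψ = ∑ q^{s(s+1)/2}. Gauss' product formula
(`tendsto_gaussProd`, `hasSum_triangular`) identifies J₁J₄/J₂ with ψ(-q). The claim becomes T = ψG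
at `-q`, where T = ∑ n q^{n² - j(j-1)/2} over 1 ≤ j ≤ n and 𝓕(q) = -G(-q).

Class numbers enter through Selling reduction. A positive form of odd discriminant is equivalent to
(Px² + Qy² + R(x-y)²)/2 with P, Q, R odd and positive, uniquely up to cyclic rotation. Hence
3H(4n-1) counts the solutions of PQ + QR + RP = 4n-1 (`three_mul_hurwitzH`). With P = 2a+1 and Q =
2b+1, F(4n-1) counts those with a ≡ b mod 2 (`kroneckerF_eq_card`). Summing over a-b gives G =
∑_{n≥1} (-1)^{n-1} q^{n²} cotanh(n) ∑_{k<n} q^{-k(k+1)} (`hasSum_tripleTerm_regroup`).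

Let φ = ∑ q^{m²} over ℤ and ψ₂ = ψ(q²). Both ψ q^{n²} ∑_{j<n} q^{-j(j+1)/2} and ψ₂ q^{n²} ∑_{k<n}
q^{-k(k+1)} have the shape ∑_m a(m) q^{(n-m)²} with a odd. Weighting the first by n and the second
by (-1)^{n+1} cotanh(n), then exchanging summations, gives 2ψT = φM and 2ψ₂G = K for explicit
Lambert-type sums M and K (`hasSum_nat_mul_triangular`, `hasSum_kronecker_relation`). Finally K = M
(`tsum_relation_eq`) and ψ² = φψ₂ (`psi_sq_eq`), so 2ψT = 2ψ²G, and ψ ≠ 0 cancels. -/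

/-! ### Infinite products and Gauss' triangular series -/

theorem one_sub_pow_ne_zero {q : ℂ} (hq : ‖q‖ < 1) {n : ℕ} (hn : n ≠ 0) : 1 - q ^ n ≠ 0 := by
  intro h
  have h1 : ‖q ^ n‖ = 1 := by rw [← sub_eq_zero.mp h]; simp
  rw [norm_pow] at h1
  exact absurd h1 (pow_lt_one₀ (norm_nonneg _) hq hn).ne

theorem summable_norm_qPoch {q : ℂ} (hq : ‖q‖ < 1) {k : ℕ} (hk : k ≠ 0) :
    Summable fun i : ℕ => ‖-(q ^ k * (q ^ k) ^ i)‖ := by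
  have h : ‖q ^ k‖ < 1 := by
    rw [norm_pow]; exact pow_lt_one₀ (norm_nonneg _) hq hk
  simp only [norm_neg, norm_mul, norm_pow _ _]
  refine Summable.mul_left _ ?_
  simp only [← norm_pow]
  simpa using summable_geometric_of_lt_one (norm_nonneg (q ^ k)) h

theorem multipliable_J {q : ℂ} (hq : ‖q‖ < 1) {k : ℕ} (hk : k ≠ 0) :
    Multipliable fun i : ℕ => 1 - q ^ k * (q ^ k) ^ i := by
  simpa [sub_eq_add_neg] using multipliable_one_add_of_summable (summable_norm_qPoch hq hk)

theorem J_ne_zero {q : ℂ} (hq : ‖q‖ < 1) {k : ℕ} (hk : k ≠ 0) : J k q ≠ 0 := by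
  have := tprod_one_add_ne_zero_of_summable (f := fun i : ℕ => -(q ^ k * (q ^ k) ^ i))
    (fun i => by
      rw [← sub_eq_add_neg, ← pow_succ', ← pow_mul]
      exact one_sub_pow_ne_zero hq (by positivity)) (summable_norm_qPoch hq hk)
  simpa [J, qPochInf, sub_eq_add_neg] using this

theorem tendsto_J {q : ℂ} (hq : ‖q‖ < 1) {k : ℕ} (hk : k ≠ 0) :
    Tendsto (fun n => ∏ i ∈ range n, (1 - q ^ (k * (i + 1)))) atTop (𝓝 (J k q)) := by
  have := (multipliable_J hq hk).hasProd.tendsto_prod_nat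
  refine this.congr fun n => prod_congr rfl fun i _ => ?_
  rw [← pow_succ', ← pow_mul]

/-- The partial products of `∏ (1 - q^{2j}) / (1 - q^{2j-1})`. -/
noncomputable def gaussProd (q : ℂ) (n : ℕ) : ℂ :=
  ∏ j ∈ range n, (1 - q ^ (2 * j + 2)) / (1 - q ^ (2 * j + 1))

theorem gaussProd_ne_zero {q : ℂ} (hq : ‖q‖ < 1) (n : ℕ) : gaussProd q n ≠ 0 :=
  Finset.prod_ne_zero_iff.mpr fun _ _ =>
    div_ne_zero (one_sub_pow_ne_zero hq (by positivity)) (one_sub_pow_ne_zero hq (by positivity))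

/-- Cutting J₁ and J₂ at 2n factors and J₄ at n factors gives an exact finite identity, because 1 -
q^{2(2j+1)} = (1 - q^{2j+1})(1 + q^{2j+1}). -/
theorem tendsto_gaussProd {q : ℂ} (hq : ‖q‖ < 1) :
    Tendsto (gaussProd (-q)) atTop (𝓝 (J 1 q * J 4 q / J 2 q)) := by
  have h2 : Tendsto (fun n : ℕ => 2 * n) atTop atTop :=
    tendsto_id.const_mul_atTop' (by norm_num)
  have h := (((tendsto_J hq one_ne_zero).comp h2).mul (tendsto_J hq four_ne_zero)).div
    ((tendsto_J hq two_ne_zero).comp h2) (J_ne_zero hq two_ne_zero)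
  refine h.congr fun n => ?_
  simp only [Function.comp, Pi.div_apply]
  induction n with
  | zero => simp [gaussProd]
  | succ n ih =>
    have e : 2 * (n + 1) = 2 * n + 1 + 1 := by ring
    have r1 : gaussProd (-q) (n + 1) = gaussProd (-q) n *
        ((1 - (-q) ^ (2 * n + 2)) / (1 - (-q) ^ (2 * n + 1))) := prod_range_succ _ _
    rw [r1, ← ih, e]
    simp only [prod_range_succ]
    have n1 : (1 : ℂ) - q ^ (2 * (2 * n + 1)) ≠ 0 := one_sub_pow_ne_zero hq (by positivity)
    have n2 : (1 : ℂ) - q ^ (2 * (2 * n + 1 + 1)) ≠ 0 := one_sub_pow_ne_zero hq (by positivity)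
    have n3 : (1 : ℂ) - (-q) ^ (2 * n + 1) ≠ 0 :=
      one_sub_pow_ne_zero (by simpa using hq) (by positivity)
    have n4 : (∏ i ∈ range (2 * n), (1 - q ^ (2 * (i + 1)))) ≠ 0 :=
      Finset.prod_ne_zero_iff.mpr fun _ _ => one_sub_pow_ne_zero hq (by positivity)
    have s1 : (-q) ^ (2 * n + 1) = -q ^ (2 * n + 1) := Odd.neg_pow ⟨n, rfl⟩ q
    have s2 : (-q) ^ (2 * n + 2) = q ^ (2 * n + 2) := Even.neg_pow ⟨n + 1, by ring⟩ q
    rw [s1, sub_neg_eq_add] at n3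
    rw [s1, s2, sub_neg_eq_add]
    field_simp
    ring

/-- Shanks' finite form of Gauss' identity for the triangular numbers. -/
theorem shanks_identity {q : ℂ} (hq : ‖q‖ < 1) (n : ℕ) :
    ∑ s ∈ range (2 * n), q ^ (s * (s + 1) / 2) =
      ∑ s ∈ range n, gaussProd q n / gaussProd q s * q ^ (s * (2 * n + 1)) := by
  induction n with
  | zero => simp
  | succ n ih =>
    have e : 2 * (n + 1) = 2 * n + 1 + 1 := by ring
    have t1 : 2 * n * (2 * n + 1) / 2 = n * (2 * n + 1) := by
      rw [mul_assoc, Nat.mul_div_cancel_left _ two_pos]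
    have t2 : (2 * n + 1) * (2 * n + 1 + 1) / 2 = (n + 1) * (2 * n + 1) := by
      rw [show (2 * n + 1) * (2 * n + 1 + 1) = 2 * ((n + 1) * (2 * n + 1)) by ring,
        Nat.mul_div_cancel_left _ two_pos]
    rw [e, sum_range_succ, sum_range_succ, ih, t1, t2]
    have hn : (1 : ℂ) - q ^ (2 * n + 1) ≠ 0 := one_sub_pow_ne_zero hq (by positivity)
    -- A telescoping certificate: passing from n to n+1 changes the s-th summand by u(s+1) - u(s).
    -- The factor 1 - q^{2s} kills u(0); u(n+1) and the new summand s = n supply the two new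
    -- triangular powers.
    let u : ℕ → ℂ := fun s =>
      gaussProd q n / gaussProd q s * (1 - q ^ (2 * s)) * q ^ (s * (2 * n + 1)) /
        (1 - q ^ (2 * n + 1))
    have hu : ∀ s, gaussProd q (n + 1) / gaussProd q s * q ^ (s * (2 * n + 1 + 1 + 1)) =
        gaussProd q n / gaussProd q s * q ^ (s * (2 * n + 1)) + (u (s + 1) - u s) := by
      intro s
      have h0 := gaussProd_ne_zero hq s
      have h1 := gaussProd_ne_zero hq (s + 1)
      have n1 : (1 : ℂ) - q ^ (2 * s + 1) ≠ 0 := one_sub_pow_ne_zero hq (by positivity)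
      have n2 : (1 : ℂ) - q ^ (2 * s + 2) ≠ 0 := one_sub_pow_ne_zero hq (by positivity)
      have r1 : gaussProd q (n + 1) =
        gaussProd q n * ((1 - q ^ (2 * n + 2)) / (1 - q ^ (2 * n + 1))) := prod_range_succ _ _
      have r2 : gaussProd q (s + 1) =
        gaussProd q s * ((1 - q ^ (2 * s + 2)) / (1 - q ^ (2 * s + 1))) := prod_range_succ _ _
      simp only [u, r1, r2, show 2 * (s + 1) = 2 * s + 2 by ring]
      field_simp
      ring
    simp only [hu, sum_add_distrib, sum_range_sub]
    have hun : u (n + 1) = q ^ ((n + 1) * (2 * n + 1)) := by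
      have h0 := gaussProd_ne_zero hq n
      have r1 : gaussProd q (n + 1) =
        gaussProd q n * ((1 - q ^ (2 * n + 2)) / (1 - q ^ (2 * n + 1))) := prod_range_succ _ _
      have n2 : (1 : ℂ) - q ^ (2 * n + 2) ≠ 0 := one_sub_pow_ne_zero hq (by positivity)
      simp only [u, r1, show 2 * (n + 1) = 2 * n + 2 by ring]
      field_simp
    rw [hun, sum_range_succ, div_self (gaussProd_ne_zero hq n)]
    simp [u]

theorem summable_norm_triangular {q : ℂ} (hq : ‖q‖ < 1) :
    Summable fun s : ℕ => ‖q ^ (s * (s + 1) / 2)‖ := by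
  refine Summable.of_nonneg_of_le (fun _ => norm_nonneg _) (fun s => ?_)
    (summable_geometric_of_lt_one (norm_nonneg q) hq)
  rw [norm_pow]
  refine pow_le_pow_of_le_one (norm_nonneg _) hq.le ?_
  rw [Nat.le_div_iff_mul_le two_pos]
  nlinarith [Nat.zero_le s, show s * s + s ≥ s * 2 by rcases s with _ | s <;> nlinarith]

/-- Gauss: `∑ q^{s(s+1)/2} = ∏ (1 - q^{2j}) / (1 - q^{2j-1})`. -/
theorem hasSum_triangular {q L : ℂ} (hq : ‖q‖ < 1) (hL : Tendsto (gaussProd q) atTop (𝓝 L))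
    (hL0 : L ≠ 0) : HasSum (fun s : ℕ => q ^ (s * (s + 1) / 2)) L := by
  have hs := (summable_norm_triangular hq).of_norm
  have h2 : Tendsto (fun n : ℕ => 2 * n) atTop atTop :=
    tendsto_id.const_mul_atTop' (by norm_num)
  have h1 := hs.hasSum.tendsto_sum_nat.comp h2
  obtain ⟨B, hB⟩ := hL.norm.bddAbove_range
  obtain ⟨D, hD⟩ := (hL.inv₀ hL0).norm.bddAbove_range
  have hB' : ∀ n, ‖gaussProd q n‖ ≤ B := fun n => hB ⟨n, rfl⟩
  have hD' : ∀ n, ‖(gaussProd q n)⁻¹‖ ≤ D := fun n => hD ⟨n, rfl⟩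
  have hB0 : 0 ≤ B := (norm_nonneg _).trans (hB' 0)
  have hD0 : 0 ≤ D := (norm_nonneg _).trans (hD' 0)
  -- In Shanks' sum only s = 0 survives in the limit: the other n summands are each at most
  -- B·D·‖q‖ⁿ.
  have key : Tendsto (fun n : ℕ => ∑ s ∈ range (n + 1),
      gaussProd q (n + 1) / gaussProd q s * q ^ (s * (2 * (n + 1) + 1))) atTop (𝓝 L) := by
    simp only [sum_range_succ']
    have hmain : Tendsto (fun n : ℕ => gaussProd q (n + 1) / gaussProd q 0 *
        q ^ (0 * (2 * (n + 1) + 1))) atTop (𝓝 L) := by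
      simpa [gaussProd] using (tendsto_add_atTop_iff_nat 1).mpr hL
    have hrest : Tendsto (fun n : ℕ => ∑ s ∈ range n, gaussProd q (n + 1) /
        gaussProd q (s + 1) * q ^ ((s + 1) * (2 * (n + 1) + 1))) atTop (𝓝 0) := by
      have hz : Tendsto (fun n : ℕ => B * D * (n * ‖q‖ ^ n)) atTop (𝓝 0) := by
        simpa using (tendsto_self_mul_const_pow_of_lt_one (norm_nonneg q) hq).const_mul (B * D)
      refine squeeze_zero_norm (fun n => ?_) hz
      refine (norm_sum_le _ _).trans ?_
      have : ∀ s ∈ range n, ‖gaussProd q (n + 1) / gaussProd q (s + 1) *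
          q ^ ((s + 1) * (2 * (n + 1) + 1))‖ ≤ B * D * ‖q‖ ^ n := by
        intro s _
        rw [norm_mul, div_eq_mul_inv, norm_mul, norm_pow]
        have : ‖q‖ ^ ((s + 1) * (2 * (n + 1) + 1)) ≤ ‖q‖ ^ n :=
          pow_le_pow_of_le_one (norm_nonneg _) hq.le (by nlinarith [Nat.zero_le (s * n)])
        have h1 := hB' (n + 1)
        have h2 := hD' (s + 1)
        gcongr
      refine (sum_le_sum this).trans ?_
      simp only [sum_const, card_range, nsmul_eq_mul]
      exact le_of_eq (by ring)
    simpa using hrest.add hmain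
  have h3 := (tendsto_add_atTop_iff_nat 1).mpr h1
  have : (∑' s : ℕ, q ^ (s * (s + 1) / 2)) = L := by
    refine tendsto_nhds_unique h3 (key.congr fun n => ?_)
    simp only [Function.comp]
    rw [shanks_identity hq]
  rw [← this]
  exact hs.hasSum

/-! ### Selling reduction of binary forms -/

namespace BinForm

/-- The sum of the values of `f` at the superbase `(1, 0), (0, 1), (1, 1)`. -/
def superSum (f : BinForm) : ℤ := 2 * f.a + 2 * f.c + f.b

/-- All three Selling parameters of the form are positive. -/
def Obtuse (f : BinForm) : Prop := 0 < 2 * f.a + f.b ∧ 0 < 2 * f.c + f.b ∧ f.b < 0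

/-- The cyclic rotation of the Selling parameters. -/
def rot (f : BinForm) : BinForm := ⟨f.a + f.b + f.c, -(2 * f.a + f.b), f.a⟩

/-- Selling's reduction step. -/
def flip (f : BinForm) : BinForm := ⟨f.c, -f.b, f.a⟩

theorem properEquiv_of_matrix {f g : BinForm} (x₁ x₂ y₁ y₂ : ℤ) (hd : x₁ * y₂ - x₂ * y₁ = 1)
    (h : ∀ x y, f.eval x y = g.eval (x₁ * x + x₂ * y) (y₁ * x + y₂ * y)) : ProperEquiv f g :=
  ⟨⟨!![x₁, x₂; y₁, y₂], by rw [Matrix.det_fin_two_of]; exact hd⟩, fun x y => by simpa using h x y⟩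

theorem rot_equiv (f : BinForm) : ProperEquiv f.rot f :=
  properEquiv_of_matrix (-1) 1 (-1) 0 (by norm_num) fun x y => by
    simp only [eval, rot]; ring

theorem flip_equiv (f : BinForm) : ProperEquiv f.flip f :=
  properEquiv_of_matrix 0 (-1) 1 0 (by norm_num) fun x y => by
    simp only [eval, flip]; ring

theorem ProperEquiv.exists_matrix {f g : BinForm} (h : ProperEquiv f g) :
    ∃ x₁ x₂ y₁ y₂ : ℤ, x₁ * y₂ - x₂ * y₁ = 1 ∧
      ∀ x y, f.eval x y = g.eval (x₁ * x + x₂ * y) (y₁ * x + y₂ * y) := by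
  obtain ⟨γ, hγ⟩ := h
  refine ⟨γ 0 0, γ 0 1, γ 1 0, γ 1 1, ?_, hγ⟩
  rw [← Matrix.det_fin_two]; exact γ.det_coe

theorem ProperEquiv.disc_eq {f g : BinForm} (h : ProperEquiv f g) : f.disc = g.disc := by
  obtain ⟨x₁, x₂, y₁, y₂, hd, h⟩ := h.exists_matrix
  have ha := h 1 0
  have hc := h 0 1
  have hb := h 1 1
  simp only [eval, mul_one, mul_zero, add_zero, zero_add, one_pow] at ha hb hc
  have hb' : f.b = 2 * g.a * x₁ * x₂ + g.b * (x₁ * y₂ + x₂ * y₁) + 2 * g.c * y₁ * y₂ := by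
    linear_combination hb - ha - hc
  have ha' : f.a = g.a * x₁ ^ 2 + g.b * x₁ * y₁ + g.c * y₁ ^ 2 := by linear_combination ha
  have hc' : f.c = g.a * x₂ ^ 2 + g.b * x₂ * y₂ + g.c * y₂ ^ 2 := by linear_combination hc
  rw [disc, disc, ha', hb', hc']
  linear_combination (g.b ^ 2 - 4 * g.a * g.c) * (x₁ * y₂ - x₂ * y₁ + 1) * hd

theorem ProperEquiv.posDef {f g : BinForm} (h : ProperEquiv f g) (hg : g.PosDef) : f.PosDef := by
  obtain ⟨x₁, x₂, y₁, y₂, hd, h⟩ := h.exists_matrix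
  intro x y hxy
  rw [h]
  refine hg _ _ fun h0 => hxy ?_
  obtain ⟨h1, h2⟩ := Prod.mk.inj h0
  refine Prod.ext ?_ ?_
  · linear_combination y₂ * h1 - x₂ * h2 - x * hd
  · linear_combination x₁ * h2 - y₁ * h1 - y * hd

/-- Selling's formula: the three parameters are the weights of x², y² and (x-y)². -/
theorem two_mul_eval (f : BinForm) (x y : ℤ) : 2 * f.eval x y =
    (2 * f.a + f.b) * x ^ 2 + (2 * f.c + f.b) * y ^ 2 + (-f.b) * (x - y) ^ 2 := by
  simp only [eval]; ring

theorem Obtuse.posDef {f : BinForm} (h : f.Obtuse) : f.PosDef := by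
  obtain ⟨h1, h2, h3⟩ := h
  intro x y hxy
  have h3' : 0 ≤ (-f.b) * (x - y) ^ 2 := mul_nonneg (by linarith) (sq_nonneg _)
  have h1' : 0 ≤ (2 * f.a + f.b) * x ^ 2 := mul_nonneg h1.le (sq_nonneg _)
  have h2' : 0 ≤ (2 * f.c + f.b) * y ^ 2 := mul_nonneg h2.le (sq_nonneg _)
  have := two_mul_eval f x y
  by_cases hx : x = 0
  · have hy : y ≠ 0 := fun hy => hxy (by rw [hx, hy])
    have : 0 < (2 * f.c + f.b) * y ^ 2 := by positivity
    linarith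
  · have : 0 < (2 * f.a + f.b) * x ^ 2 := by positivity
    linarith

/-- The sum is twice the hexagonal form x² + xy + y², which is a positive integer away from the
origin. -/
theorem sq_sum_ge_two {x y : ℤ} (h : ¬(x = 0 ∧ y = 0)) : 2 ≤ x ^ 2 + y ^ 2 + (x + y) ^ 2 := by
  have h0 : 0 < x ^ 2 + x * y + y ^ 2 := by
    by_contra hc
    have h4 : (2 * x + y) ^ 2 + 3 * y ^ 2 ≤ 0 := by nlinarith
    have hy : y = 0 := by
      by_contra hy
      have : 0 < y ^ 2 := by positivity
      nlinarith [sq_nonneg (2 * x + y)]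
    subst hy
    have hx : x = 0 := by
      by_contra hx
      have : 0 < x ^ 2 := by positivity
      nlinarith
    exact h ⟨hx, rfl⟩
  nlinarith

/-- Selling's formula at the images of the superbase groups the matrix entries by rows: each
parameter of g multiplies twice a value of the hexagonal form, taken at a row or at the difference
of the rows. -/
theorem two_mul_superSum {f g : BinForm} {x₁ x₂ y₁ y₂ : ℤ}
    (h : ∀ x y, f.eval x y = g.eval (x₁ * x + x₂ * y) (y₁ * x + y₂ * y)) :
    2 * f.superSum = (2 * g.a + g.b) * (x₁ ^ 2 + x₂ ^ 2 + (x₁ + x₂) ^ 2) +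
      (2 * g.c + g.b) * (y₁ ^ 2 + y₂ ^ 2 + (y₁ + y₂) ^ 2) +
      (-g.b) * ((x₁ - y₁) ^ 2 + (x₂ - y₂) ^ 2 + ((x₁ - y₁) + (x₂ - y₂)) ^ 2) := by
  have ha := h 1 0
  have hc := h 0 1
  have hb := h 1 1
  simp only [eval, mul_one, mul_zero, add_zero, zero_add, one_pow] at ha hb hc
  rw [superSum]
  linear_combination 2 * ha + 2 * hc + 2 * hb

theorem rows_ne_zero {x₁ x₂ y₁ y₂ : ℤ} (hd : x₁ * y₂ - x₂ * y₁ = 1) :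
    ¬(x₁ = 0 ∧ x₂ = 0) ∧ ¬(y₁ = 0 ∧ y₂ = 0) ∧ ¬(x₁ - y₁ = 0 ∧ x₂ - y₂ = 0) := by
  refine ⟨?_, ?_, ?_⟩
  · rintro ⟨rfl, rfl⟩; simp at hd
  · rintro ⟨rfl, rfl⟩; simp at hd
  · rintro ⟨h1, h2⟩
    obtain rfl := sub_eq_zero.mp h1
    obtain rfl := sub_eq_zero.mp h2
    rw [mul_comm, sub_self] at hd
    exact zero_ne_one hd

/-- Both rows and their difference are nonzero, so each of the three factors is at least 2; all of
them equal to 2 gives the sum of g itself. -/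
theorem Obtuse.superSum_le {f g : BinForm} (hg : g.Obtuse) (h : ProperEquiv f g) :
    g.superSum ≤ f.superSum := by
  obtain ⟨x₁, x₂, y₁, y₂, hd, h⟩ := h.exists_matrix
  obtain ⟨hx, hy, hz⟩ := rows_ne_zero hd
  have hx := sq_sum_ge_two hx
  have hy := sq_sum_ge_two hy
  have hz := sq_sum_ge_two hz
  have e := two_mul_superSum h
  obtain ⟨h1, h2, h3⟩ := hg
  have h3' : 0 < -g.b := by linarith
  have := mul_le_mul_of_nonneg_left hx h1.le
  have := mul_le_mul_of_nonneg_left hy h2.le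
  have := mul_le_mul_of_nonneg_left hz h3'.le
  simp only [superSum] at *
  linarith

theorem entry_cases {x y : ℤ} (h : x ^ 2 + y ^ 2 + (x + y) ^ 2 = 2) :
    (x = 1 ∧ y = 0) ∨ (x = 0 ∧ y = 1) ∨ (x = 1 ∧ y = -1) ∨ (x = -1 ∧ y = 0) ∨
      (x = 0 ∧ y = -1) ∨ (x = -1 ∧ y = 1) := by
  have hx : -1 ≤ x ∧ x ≤ 1 := ⟨by nlinarith [sq_nonneg (x + 2 * y)], by
    nlinarith [sq_nonneg (x + 2 * y)]⟩
  have hy : -1 ≤ y ∧ y ≤ 1 := ⟨by nlinarith [sq_nonneg (2 * x + y)], by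
    nlinarith [sq_nonneg (2 * x + y)]⟩
  obtain ⟨h1, h2⟩ := hx
  obtain ⟨h3, h4⟩ := hy
  interval_cases x <;> interval_cases y <;> simp_all

/-- Two obtuse forms are equivalent only if they are rotations of each other. -/
theorem Obtuse.eq_rot {f g : BinForm} (hf : f.Obtuse) (hg : g.Obtuse) (h : ProperEquiv f g) :
    f = g ∨ f = g.rot ∨ f = g.rot.rot := by
  have hs : f.superSum = g.superSum :=
    le_antisymm (hf.superSum_le (properEquiv_symm h)) (hg.superSum_le h)
  obtain ⟨x₁, x₂, y₁, y₂, hd, h⟩ := h.exists_matrix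
  obtain ⟨hx, hy, hz⟩ := rows_ne_zero hd
  have hx := sq_sum_ge_two hx
  have hy := sq_sum_ge_two hy
  have hz := sq_sum_ge_two hz
  have e := two_mul_superSum h
  rw [hs, superSum] at e
  obtain ⟨h1, h2, h3⟩ := hg
  have h3' : 0 < -g.b := by linarith
  have m1 := mul_le_mul_of_nonneg_left hx h1.le
  have m2 := mul_le_mul_of_nonneg_left hy h2.le
  have m3 := mul_le_mul_of_nonneg_left hz h3'.le
  -- Equal sums and strictly positive weights force equality in each of the three bounds.
  have ex : x₁ ^ 2 + x₂ ^ 2 + (x₁ + x₂) ^ 2 = 2 := by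
    refine mul_left_cancel₀ h1.ne' ?_
    linarith
  have ey : y₁ ^ 2 + y₂ ^ 2 + (y₁ + y₂) ^ 2 = 2 := by
    refine mul_left_cancel₀ h2.ne' ?_
    linarith
  have ez : (x₁ - y₁) ^ 2 + (x₂ - y₂) ^ 2 + ((x₁ - y₁) + (x₂ - y₂)) ^ 2 = 2 := by
    refine mul_left_cancel₀ h3'.ne' ?_
    linarith
  have ha := h 1 0
  have hc := h 0 1
  have hb := h 1 1
  simp only [eval, mul_one, mul_zero, add_zero, zero_add, one_pow] at ha hb hc
  simp only [BinForm.ext_iff, rot]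
  rcases entry_cases ex with ⟨rfl, rfl⟩ | ⟨rfl, rfl⟩ | ⟨rfl, rfl⟩ | ⟨rfl, rfl⟩ | ⟨rfl, rfl⟩ |
    ⟨rfl, rfl⟩ <;>
  rcases entry_cases ey with ⟨rfl, rfl⟩ | ⟨rfl, rfl⟩ | ⟨rfl, rfl⟩ | ⟨rfl, rfl⟩ | ⟨rfl, rfl⟩ |
    ⟨rfl, rfl⟩ <;>
  -- Of the 36 pairs of rows, 30 violate the determinant or the condition on the difference; the
  -- remaining six are the three rotations up to sign.
  first
  | (exfalso; revert hd ez; norm_num; done)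
  | (norm_num at ha hb hc ⊢; omega)

theorem Obtuse.rot {f : BinForm} (h : f.Obtuse) : f.rot.Obtuse := by
  obtain ⟨h1, h2, h3⟩ := h
  refine ⟨?_, ?_, ?_⟩ <;> simp only [BinForm.rot] <;> linarith

theorem superSum_pos {f : BinForm} (hf : f.PosDef) : 0 < f.superSum := by
  have h1 := hf 1 0 (by simp)
  have h2 := hf 0 1 (by simp)
  have h3 := hf 1 1 (by simp)
  simp only [eval, superSum] at *
  linarith

/-- Selling reduction. -/
theorem exists_obtuse (n : ℕ) : ∀ f : BinForm, f.PosDef → Odd f.b → f.superSum ≤ n →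
    ∃ g : BinForm, g.Obtuse ∧ ProperEquiv g f := by
  induction n with
  | zero =>
    intro f hf _ hn
    exact absurd (superSum_pos hf) (by simpa using hn)
  | succ n ih =>
    intro f hf hb hn
    push_cast at hn
    have hb0 : f.b ≠ 0 := by rintro h; rw [h] at hb; simp at hb
    -- Flipping a form with positive middle coefficient lowers the superbase sum by twice that
    -- coefficient, so the induction hypothesis applies.
    have step : ∀ g : BinForm, ProperEquiv g f → Odd g.b → g.superSum = f.superSum → 0 < g.b →
        ∃ g : BinForm, g.Obtuse ∧ ProperEquiv g f := by
      intro g hg ho hs hpos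
      have he : ProperEquiv g.flip f := properEquiv_trans (flip_equiv g) hg
      obtain ⟨u, hu, hu'⟩ := ih g.flip (he.posDef hf) (by simpa [flip] using ho) (by
        simp only [superSum, flip] at *; linarith)
      exact ⟨u, hu, properEquiv_trans hu' he⟩
    have e1 := rot_equiv f
    have e2 := properEquiv_trans (rot_equiv f.rot) e1
    have s1 : f.rot.superSum = f.superSum := by simp only [superSum, rot]; ring
    have s2 : f.rot.rot.superSum = f.superSum := by simp only [superSum, rot]; ring
    have o1 : Odd f.rot.b := by simp only [rot]; obtain ⟨t, ht⟩ := hb; exact ⟨-f.a - t - 1, by omega⟩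
    have o2 : Odd f.rot.rot.b := by
      simp only [rot]; obtain ⟨t, ht⟩ := hb; exact ⟨-f.c - t - 1, by omega⟩
    by_cases c0 : 0 < f.b
    · exact step f (properEquiv_refl f) hb rfl c0
    by_cases c1 : 0 < f.rot.b
    · exact step _ e1 o1 s1 c1
    by_cases c2 : 0 < f.rot.rot.b
    · exact step _ e2 o2 s2 c2
    -- The three middle coefficients are odd, so not being positive makes them strictly negative.
    refine ⟨f, ⟨?_, ?_, ?_⟩, properEquiv_refl f⟩
    · obtain ⟨t, ht⟩ := o1; simp only [rot] at *; omega
    · obtain ⟨t, ht⟩ := o2; simp only [rot] at *; omega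
    · omega

end BinForm

/-! ### Class numbers as counts of triples -/

/-- The solutions `(a, b, k)` of `PQ + QR + RP = 4n - 1` with `P = 2a+1`, `Q = 2b+1`,
`R = 2k+1`. -/
def tripleSet (n : ℕ) : Finset (ℕ × ℕ × ℕ) :=
  (range n ×ˢ range n ×ˢ range n).filter fun t =>
    t.1 * t.2.1 + t.2.1 * t.2.2 + t.2.2 * t.1 + t.1 + t.2.1 + t.2.2 + 1 = n

theorem mem_tripleSet {n a b k : ℕ} :
    (a, b, k) ∈ tripleSet n ↔ a * b + b * k + k * a + a + b + k + 1 = n := by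
  simp only [tripleSet, mem_filter, mem_product, mem_range, and_iff_right_iff_imp]
  intro h
  have h1 := Nat.zero_le (a * b)
  have h2 := Nat.zero_le (b * k)
  have h3 := Nat.zero_le (k * a)
  refine ⟨?_, ?_, ?_⟩ <;> omega

/-- The form with Selling parameters `(2a+1, 2b+1, 2k+1)` (up to a factor two). -/
def tripleForm (t : ℕ × ℕ × ℕ) : BinForm := ⟨t.1 + t.2.2 + 1, -(2 * t.2.2 + 1), t.2.1 + t.2.2 + 1⟩

/-- Cyclic rotation of triples. -/
def tripleRot (t : ℕ × ℕ × ℕ) : ℕ × ℕ × ℕ := (t.2.1, t.2.2, t.1)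

theorem tripleForm_rot (t : ℕ × ℕ × ℕ) : tripleForm (tripleRot t) = (tripleForm t).rot := by
  obtain ⟨a, b, k⟩ := t
  simp only [tripleForm, tripleRot, BinForm.rot, BinForm.mk.injEq]
  refine ⟨?_, ?_, ?_⟩ <;> ring

theorem tripleForm_injective : Function.Injective tripleForm := by
  rintro ⟨a, b, k⟩ ⟨a', b', k'⟩ h
  simp only [tripleForm, BinForm.mk.injEq] at h
  simp only [Prod.mk.injEq]
  omega

theorem tripleForm_obtuse (t : ℕ × ℕ × ℕ) : (tripleForm t).Obtuse := by
  refine ⟨?_, ?_, ?_⟩ <;> simp only [tripleForm] <;> omega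

theorem tripleForm_disc {n : ℕ} {t : ℕ × ℕ × ℕ} :
    (tripleForm t).disc = 1 - 4 * n ↔ t ∈ tripleSet n := by
  obtain ⟨a, b, k⟩ := t
  rw [mem_tripleSet, ← Int.natCast_inj]
  simp only [tripleForm, BinForm.disc]
  push_cast
  constructor <;> intro h <;> linarith

theorem tripleRot_mem {n : ℕ} {t : ℕ × ℕ × ℕ} (ht : t ∈ tripleSet n) :
    tripleRot t ∈ tripleSet n := by
  obtain ⟨a, b, k⟩ := t
  rw [tripleRot, mem_tripleSet]
  rw [mem_tripleSet] at ht
  linarith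

theorem natCast_four_mul_sub_one {n : ℕ} (hn : 1 ≤ n) :
    -((4 * n - 1 : ℕ) : ℤ) = 1 - 4 * n := by
  rw [Nat.cast_sub (by omega)]; push_cast; ring

/-- The class of the form of a triple. -/
def tripleClass {n : ℕ} (hn : 1 ≤ n) (t : tripleSet n) : FormClasses (4 * n - 1) :=
  Quotient.mk (formsSetoid _) ⟨tripleForm t, (tripleForm_obtuse _).posDef, by
    rw [natCast_four_mul_sub_one hn]; exact tripleForm_disc.mpr t.2⟩

theorem odd_b_of_disc {f : BinForm} {n : ℕ} (h : f.disc = 1 - 4 * n) : Odd f.b := by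
  rw [BinForm.disc] at h
  rw [← Int.not_even_iff_odd]
  rintro ⟨t, ht⟩
  rw [ht] at h
  have : 4 * (t * t - f.a * f.c + n) = 1 := by linear_combination h
  omega

theorem exists_triple_of_obtuse {f : BinForm} (hf : f.Obtuse) (hb : Odd f.b) :
    ∃ t, tripleForm t = f := by
  obtain ⟨h1, h2, h3⟩ := hf
  obtain ⟨s, hs⟩ := hb
  refine ⟨((f.a + s).toNat, (f.c + s).toNat, (-s - 1).toNat), ?_⟩
  simp only [tripleForm, BinForm.ext_iff]
  omega

theorem tripleClass_surjective {n : ℕ} (hn : 1 ≤ n) : Function.Surjective (tripleClass hn) := by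
  intro C
  induction C using Quotient.inductionOn with
  | h f =>
    obtain ⟨f, hf, hd⟩ := f
    rw [natCast_four_mul_sub_one hn] at hd
    obtain ⟨g, hg, he⟩ := BinForm.exists_obtuse f.superSum.toNat f hf (odd_b_of_disc hd)
      (Int.self_le_toNat _)
    have hgd : g.disc = 1 - 4 * n := he.disc_eq.trans hd
    obtain ⟨t, rfl⟩ := exists_triple_of_obtuse hg (odd_b_of_disc hgd)
    exact ⟨⟨t, tripleForm_disc.mp hgd⟩, Quotient.sound he⟩

theorem tripleClass_eq_iff {n : ℕ} (hn : 1 ≤ n) (s t : tripleSet n) :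
    tripleClass hn s = tripleClass hn t ↔
      s.1 = t.1 ∨ s.1 = tripleRot t.1 ∨ s.1 = tripleRot (tripleRot t.1) := by
  refine (Quotient.eq (r := formsSetoid (4 * n - 1))).trans ?_
  constructor
  · intro h
    have := (tripleForm_obtuse s.1).eq_rot (tripleForm_obtuse t.1) h
    simpa only [← tripleForm_rot, tripleForm_injective.eq_iff] using this
  · rintro (h | h | h)
    · rw [show s = t from Subtype.ext h]
      exact BinForm.properEquiv_refl _
    · change BinForm.ProperEquiv (tripleForm s.1) (tripleForm t.1)
      rw [h, tripleForm_rot]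
      exact BinForm.rot_equiv _
    · change BinForm.ProperEquiv (tripleForm s.1) (tripleForm t.1)
      rw [h, tripleForm_rot, tripleForm_rot]
      exact BinForm.properEquiv_trans (BinForm.rot_equiv _) (BinForm.rot_equiv _)

/-- Weight 1/2 cannot occur, as the middle coefficient is odd. A multiple of x² + xy + y² flips to
an obtuse form fixed by rotation, and so corresponds to a triple fixed by rotation. -/
theorem classWeight_tripleClass {n : ℕ} (hn : 1 ≤ n) (t : tripleSet n) :
    classWeight (tripleClass hn t) = if tripleRot t.1 = t.1 then 1 / 3 else 1 := by
  have hfirst : ¬∃ f : Forms (4 * n - 1), Quotient.mk (formsSetoid _) f = tripleClass hn t ∧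
      ∃ k : ℤ, f.1 = ⟨k, 0, k⟩ := by
    rintro ⟨⟨f, hf, hd⟩, -, k, hk⟩
    rw [natCast_four_mul_sub_one hn] at hd
    obtain rfl : f = ⟨k, 0, k⟩ := hk
    have := odd_b_of_disc hd
    simp at this
  have hsecond : (∃ f : Forms (4 * n - 1), Quotient.mk (formsSetoid _) f = tripleClass hn t ∧
      ∃ k : ℤ, f.1 = ⟨k, k, k⟩) ↔ tripleRot t.1 = t.1 := by
    have hkk : ∀ k : ℤ, BinForm.ProperEquiv ⟨k, k, k⟩ ⟨k, -k, k⟩ := fun k => by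
      have := BinForm.flip_equiv ⟨k, -k, k⟩
      rwa [BinForm.flip, neg_neg] at this
    constructor
    · rintro ⟨⟨f, hf, hd⟩, he, k, hk⟩
      obtain rfl : f = ⟨k, k, k⟩ := hk
      have hk0 : 0 < k := by simpa [BinForm.eval] using hf 1 0 (by simp)
      have ho : BinForm.Obtuse ⟨k, -k, k⟩ := by
        refine ⟨?_, ?_, ?_⟩ <;> simp only <;> linarith
      have he' : BinForm.ProperEquiv ⟨k, k, k⟩ (tripleForm t.1) := Quotient.exact he
      have hr : BinForm.rot ⟨k, -k, k⟩ = ⟨k, -k, k⟩ := by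
        ext <;> simp only [BinForm.rot] <;> omega
      have h := (tripleForm_obtuse t.1).eq_rot ho
        (BinForm.properEquiv_trans (BinForm.properEquiv_symm he') (hkk k))
      rw [hr, hr, or_self, or_self] at h
      apply tripleForm_injective
      rw [tripleForm_rot, h, hr]
    · intro h
      obtain ⟨⟨a, b, k⟩, ht⟩ := t
      simp only [tripleRot, Prod.mk.injEq] at h
      obtain ⟨rfl, rfl, -⟩ := h
      have hT : tripleForm (k, k, k) = ⟨2 * k + 1, -(2 * k + 1), 2 * k + 1⟩ := by
        ext <;> simp only [tripleForm] <;> omega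
      have hE : BinForm.ProperEquiv ⟨2 * k + 1, 2 * k + 1, 2 * k + 1⟩ (tripleForm (k, k, k)) := by
        rw [hT]; exact hkk _
      refine ⟨⟨⟨2 * k + 1, 2 * k + 1, 2 * k + 1⟩, hE.posDef (tripleForm_obtuse _).posDef, ?_⟩,
        Quotient.sound hE, _, rfl⟩
      rw [hE.disc_eq, natCast_four_mul_sub_one hn]
      exact tripleForm_disc.mpr ht
  rw [classWeight, if_neg hfirst]
  simp only [hsecond]

theorem card_orbit (t : ℕ × ℕ × ℕ) : (({t, tripleRot t, tripleRot (tripleRot t)} : Finset _).card : ℚ)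
    = 3 * if tripleRot t = t then 1 / 3 else 1 := by
  obtain ⟨a, b, k⟩ := t
  split_ifs with h
  · rw [h, h]; simp
  · have h' : ¬(b = a ∧ k = b ∧ a = k) := by simpa [tripleRot] using h
    rw [Finset.card_eq_three.mpr ⟨_, _, _, ?_, ?_, ?_, rfl⟩]
    · norm_num
    all_goals
      simp only [tripleRot, ne_eq, Prod.mk.injEq]
      omega

/-- The fibre of `tripleClass` over a class is a rotation orbit, whose size (3 or 1) is three times
the weight of the class. -/
theorem three_mul_hurwitzH {n : ℕ} (hn : 1 ≤ n) :
    3 * hurwitzH (4 * n - 1) = (tripleSet n).card := by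
  classical
  have hfin : Finite (FormClasses (4 * n - 1)) := Finite.of_surjective _ (tripleClass_surjective hn)
  have := Fintype.ofFinite (FormClasses (4 * n - 1))
  rw [hurwitzH, if_neg (by omega), if_neg (by omega), finsum_eq_sum_of_fintype, Finset.mul_sum]
  have hc : (tripleSet n).card = (univ : Finset (tripleSet n)).card := by simp
  rw [hc, Finset.card_eq_sum_card_fiberwise (f := tripleClass hn) (t := univ) (by simp)]
  push_cast
  refine Finset.sum_congr rfl fun C _ => ?_
  obtain ⟨t, rfl⟩ := tripleClass_surjective hn C
  rw [classWeight_tripleClass, ← card_orbit, ← Finset.card_map (Function.Embedding.subtype _)]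
  congr 2
  ext s
  simp only [mem_insert, mem_singleton, Finset.mem_map, mem_filter, mem_univ, true_and,
    tripleClass_eq_iff, Function.Embedding.coe_subtype, Subtype.exists, exists_and_right,
    exists_eq_right, exists_prop]
  constructor
  · intro h
    refine ⟨?_, h⟩
    rcases h with rfl | rfl | rfl
    · exact t.2
    · exact tripleRot_mem t.2
    · exact tripleRot_mem (tripleRot_mem t.2)
  · rintro ⟨_, h⟩
    exact h

/-- The triples with `a ≡ b (mod 2)`. -/
def evenTriples (n : ℕ) : Finset (ℕ × ℕ × ℕ) :=
  (tripleSet n).filter fun t => t.1 % 2 = t.2.1 % 2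

theorem tripleSet_parity {n a b k : ℕ} (h : (a, b, k) ∈ tripleSet n) :
    (n % 2 = 1 → a % 2 = b % 2 ∧ b % 2 = k % 2) ∧
      (n % 2 = 0 → ¬(a % 2 = b % 2 ∧ b % 2 = k % 2)) := by
  rw [mem_tripleSet] at h
  subst h
  rcases Nat.mod_two_eq_zero_or_one a with ha | ha <;>
  rcases Nat.mod_two_eq_zero_or_one b with hb | hb <;>
  rcases Nat.mod_two_eq_zero_or_one k with hk | hk <;>
  simp [Nat.add_mod, Nat.mul_mod, ha, hb, hk]

/-- For odd n all three entries share their parity, and the count is 3H. For even n exactly one of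
the three cyclic pairs agrees in parity; rotation makes the three cases equally frequent, so the
count is H. -/
theorem kroneckerF_eq_card {n : ℕ} (hn : 1 ≤ n) :
    kroneckerF (4 * (n : ℤ) - 1) = (evenTriples n).card := by
  have hH := three_mul_hurwitzH hn
  have htn : (4 * (n : ℤ) - 1).toNat = 4 * n - 1 := by omega
  rw [kroneckerF, if_neg (by omega), htn]
  rcases Nat.mod_two_eq_zero_or_one n with h | h
  · rw [if_pos (by omega)]
    have hrot : ∀ p : ℕ × ℕ × ℕ → Prop, [DecidablePred p] →
        ((tripleSet n).filter fun t => p (tripleRot t)).card = ((tripleSet n).filter p).card := by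
      intro p _
      refine Finset.card_bij' (fun t _ => tripleRot t) (fun t _ => tripleRot (tripleRot t))
        ?_ ?_ (fun _ _ => rfl) (fun _ _ => rfl)
      · intro t ht
        rw [mem_filter] at ht ⊢
        exact ⟨tripleRot_mem ht.1, ht.2⟩
      · intro t ht
        rw [mem_filter] at ht ⊢
        exact ⟨tripleRot_mem (tripleRot_mem ht.1), ht.2⟩
    have e1 : ((tripleSet n).filter fun t => t.2.1 % 2 = t.2.2 % 2).card =
        (evenTriples n).card := hrot fun t => t.1 % 2 = t.2.1 % 2
    have e2 : ((tripleSet n).filter fun t => t.2.2 % 2 = t.1 % 2).card =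
        ((tripleSet n).filter fun t => t.2.1 % 2 = t.2.2 % 2).card :=
      hrot fun t => t.2.1 % 2 = t.2.2 % 2
    have hsplit : (tripleSet n).card = (evenTriples n).card +
        ((tripleSet n).filter fun t => t.2.1 % 2 = t.2.2 % 2).card +
        ((tripleSet n).filter fun t => t.2.2 % 2 = t.1 % 2).card := by
      rw [evenTriples, Finset.card_filter, Finset.card_filter, Finset.card_filter,
        ← Finset.sum_add_distrib, ← Finset.sum_add_distrib, Finset.card_eq_sum_ones]
      refine Finset.sum_congr rfl ?_
      rintro ⟨a, b, k⟩ ht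
      have := (tripleSet_parity ht).2 h
      simp only
      split_ifs <;> omega
    rw [hsplit, e2, e1] at hH
    push_cast at hH
    linarith
  · rw [if_neg (by omega), if_pos (by omega), hH, evenTriples, Finset.filter_true_of_mem]
    rintro ⟨a, b, k⟩ ht
    exact ((tripleSet_parity ht).1 h).1

/-! ### Hyperbolic functions: parity and bounds -/

/-- `q^m / (1 - q^{2m})`, half a hyperbolic cosecant; its value at `m = 0` is `0`. -/
noncomputable def cosech (q : ℂ) (m : ℤ) : ℂ := q ^ m / (1 - q ^ (2 * m))

/-- `(1 + q^{2m}) / (1 - q^{2m})`, a hyperbolic cotangent; its value at `m = 0` is `0`. -/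
noncomputable def cotanh (q : ℂ) (m : ℤ) : ℂ := (1 + q ^ (2 * m)) / (1 - q ^ (2 * m))

@[simp] theorem cosech_zero (q : ℂ) : cosech q 0 = 0 := by simp [cosech]

@[simp] theorem cotanh_zero (q : ℂ) : cotanh q 0 = 0 := by simp [cotanh]

section

variable {q : ℂ}

theorem one_sub_zpow_ne_zero (hq : ‖q‖ < 1) {m : ℤ} (hm : m ≠ 0) :
    1 - q ^ m ≠ 0 := by
  intro h
  have h1 : ‖q‖ ^ m = 1 := by rw [← norm_zpow, ← sub_eq_zero.mp h, norm_one]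
  exact hm ((zpow_eq_one_iff_right₀ (norm_nonneg q) hq.ne).mp h1)

theorem cosech_neg (hq0 : q ≠ 0) (m : ℤ) : cosech q (-m) = -cosech q m := by
  rcases eq_or_ne (1 - q ^ (2 * m)) 0 with h | h
  · have h2 : q ^ (2 * m) = 1 := (sub_eq_zero.mp h).symm
    simp [cosech, mul_neg, zpow_neg, h2]
  · have h3 : q ^ (2 * m) - 1 ≠ 0 := by rw [← neg_sub]; exact neg_ne_zero.mpr h
    have h4 : q ^ (2 * m) = q ^ m * q ^ m := by rw [two_mul, zpow_add₀ hq0]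
    have hm : q ^ m ≠ 0 := zpow_ne_zero _ hq0
    rw [cosech, cosech, mul_neg, zpow_neg, zpow_neg]
    rw [h4] at *
    field_simp
    rw [← neg_sub, div_neg, neg_div']

theorem cotanh_neg (hq0 : q ≠ 0) (m : ℤ) : cotanh q (-m) = -cotanh q m := by
  rcases eq_or_ne (1 - q ^ (2 * m)) 0 with h | h
  · have h2 : q ^ (2 * m) = 1 := (sub_eq_zero.mp h).symm
    simp [cotanh, mul_neg, zpow_neg, h2]
  · have h3 : q ^ (2 * m) - 1 ≠ 0 := by rw [← neg_sub]; exact neg_ne_zero.mpr h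
    have hm : q ^ (2 * m) ≠ 0 := zpow_ne_zero _ hq0
    rw [cotanh, cotanh, mul_neg, zpow_neg]
    field_simp
    ring

theorem norm_one_sub_zpow_ge (hq : ‖q‖ < 1) {n : ℕ} (hn : n ≠ 0) :
    1 - ‖q‖ ≤ ‖1 - q ^ (2 * (n : ℤ))‖ := by
  have h1 : ‖q ^ (2 * (n : ℤ))‖ ≤ ‖q‖ := by
    rw [norm_zpow, show (2 * (n : ℤ)) = ((2 * n : ℕ) : ℤ) by push_cast; ring, zpow_natCast]
    exact pow_le_of_le_one (norm_nonneg _) hq.le (by omega)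
  have := norm_sub_norm_le (1 : ℂ) (q ^ (2 * (n : ℤ)))
  rw [norm_one] at this
  linarith

theorem norm_cosech_le (hq0 : q ≠ 0) (hq : ‖q‖ < 1) (m : ℤ) :
    ‖cosech q m‖ ≤ 1 / (1 - ‖q‖) * ‖q‖ ^ m.natAbs := by
  have h1 : 0 < 1 - ‖q‖ := by linarith
  have key : ∀ n : ℕ, ‖cosech q n‖ ≤ 1 / (1 - ‖q‖) * ‖q‖ ^ n := by
    intro n
    rcases eq_or_ne n 0 with rfl | hn
    · simp only [Nat.cast_zero, cosech_zero, norm_zero]; positivity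
    · rw [cosech, norm_div, zpow_natCast, norm_pow, one_div_mul_eq_div]
      have := norm_one_sub_zpow_ge hq hn
      gcongr
  obtain ⟨n, rfl | rfl⟩ := m.eq_nat_or_neg
  · simpa using key n
  · rw [cosech_neg hq0, norm_neg]; simpa using key n

theorem norm_cotanh_le (hq0 : q ≠ 0) (hq : ‖q‖ < 1) (m : ℤ) :
    ‖cotanh q m‖ ≤ 2 / (1 - ‖q‖) := by
  have h1 : 0 < 1 - ‖q‖ := by linarith
  have key : ∀ n : ℕ, ‖cotanh q n‖ ≤ 2 / (1 - ‖q‖) := by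
    intro n
    rcases eq_or_ne n 0 with rfl | hn
    · simp only [Nat.cast_zero, cotanh_zero, norm_zero]; positivity
    · rw [cotanh, norm_div]
      have := norm_one_sub_zpow_ge hq hn
      have h2 : ‖1 + q ^ (2 * (n : ℤ))‖ ≤ 2 := by
        refine (norm_add_le _ _).trans ?_
        rw [norm_one, norm_zpow, show (2 * (n : ℤ)) = ((2 * n : ℕ) : ℤ) by push_cast; ring,
          zpow_natCast]
        have := pow_le_one₀ (norm_nonneg q) hq.le (n := 2 * n)
        linarith
      gcongr
  obtain ⟨n, rfl | rfl⟩ := m.eq_nat_or_neg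
  · simpa using key n
  · rw [cotanh_neg hq0, norm_neg]; simpa using key n

theorem summable_pow_natAbs {r : ℝ} (h0 : 0 ≤ r) (h1 : r < 1) :
    Summable fun m : ℤ => r ^ m.natAbs :=
  Summable.of_nat_of_neg (by simpa using summable_geometric_of_lt_one h0 h1)
    (by simpa using summable_geometric_of_lt_one h0 h1)

theorem summable_natAbs_mul_pow {r : ℝ} (h0 : 0 ≤ r) (h1 : r < 1) :
    Summable fun m : ℤ => (m.natAbs : ℝ) * r ^ m.natAbs := by
  have := summable_pow_mul_geometric_of_norm_lt_one 1 (r := r) (by rwa [Real.norm_of_nonneg h0])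
  simp only [pow_one] at this
  exact Summable.of_nat_of_neg (by simpa using this) (by simpa using this)

theorem norm_zpow_le (hq0 : q ≠ 0) (hq : ‖q‖ < 1) {e c m : ℤ} (h : |m| - c ≤ e) :
    ‖q ^ e‖ ≤ ‖q‖ ^ (-c) * ‖q‖ ^ m.natAbs := by
  rw [norm_zpow, ← zpow_natCast, ← zpow_add₀ (norm_ne_zero_iff.mpr hq0)]
  refine zpow_le_zpow_right_of_le_one₀ (norm_pos_iff.mpr hq0) hq.le ?_
  rw [Int.natCast_natAbs]; linarith

theorem summable_norm_zpow (hq0 : q ≠ 0) (hq : ‖q‖ < 1) (e : ℤ → ℤ) (c : ℤ)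
    (h : ∀ m, |m| - c ≤ e m) : Summable fun m => ‖q ^ e m‖ :=
  Summable.of_nonneg_of_le (fun _ => norm_nonneg _) (fun m => norm_zpow_le hq0 hq (h m))
    ((summable_pow_natAbs (norm_nonneg q) hq).mul_left _)

theorem abs_sub_le_sq_add (m b : ℤ) : |m| - (|b| + 1) ^ 2 ≤ m ^ 2 + b * m := by
  have h1 : -(|b| * |m|) ≤ b * m := by rw [← abs_mul]; exact neg_abs_le _
  have h2 : |m| ^ 2 = m ^ 2 := sq_abs m
  nlinarith [sq_nonneg (|m| - (|b| + 1)), abs_nonneg m, abs_nonneg b]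

theorem abs_le_sq (m : ℤ) : |m| - 0 ≤ m ^ 2 := by
  have := Int.natAbs_le_self_sq m
  rw [Int.natCast_natAbs] at this
  linarith

theorem summable_norm_sq (hq0 : q ≠ 0) (hq : ‖q‖ < 1) :
    Summable fun m : ℤ => ‖q ^ (m ^ 2)‖ := summable_norm_zpow hq0 hq _ 0 abs_le_sq

end

/-! ### Summation over the integers: symmetry, parity and telescoping -/

theorem hasSum_of_eq {ι : Type*} {f g : ι → ℂ} {a b : ℂ} (h : HasSum f a) (hf : ∀ i, g i = f i)
    (ha : b = a) : HasSum g b := by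
  rw [ha, funext hf]; exact h

theorem hasSum_equiv {ι κ : Type*} {f : ι → ℂ} {g : κ → ℂ} {a : ℂ} (e : κ ≃ ι) (h : HasSum f a)
    (hg : ∀ i, g i = f (e i)) : HasSum g a := by
  rw [funext hg]; exact e.hasSum_iff.mpr h

/-- The product of two sums over complex families. -/
theorem hasSum_mul {ι κ : Type*} {f : ι → ℂ} {g : κ → ℂ} {s t : ℂ} (hf : HasSum f s)
    (hg : HasSum g t) : HasSum (fun x : ι × κ => f x.1 * g x.2) (s * t) :=
  hf.mul hg (summable_mul_of_summable_norm hf.summable.norm hg.summable.norm)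

/-- A sum that changes sign under a bijection of the index set vanishes. -/
theorem hasSum_zero_of_equiv {ι : Type*} {f : ι → ℂ} (hf : Summable f) (e : ι ≃ ι)
    (h : ∀ i, f (e i) = -f i) : HasSum f 0 := by
  have h1 := hf.hasSum
  have h2 : HasSum (fun i => -f i) (∑' i, f i) := by
    simpa only [Function.comp_def, h] using e.hasSum_iff.mpr h1
  have h3 := h2.unique h1.neg
  have : (∑' i, f i) = 0 := by linear_combination h3 / 2
  rwa [this] at h1

theorem hasSum_zero_of_odd {f : ℤ → ℂ} (hf : Summable f) (h : ∀ m, f (-m) = -f m) :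
    HasSum f 0 := hasSum_zero_of_equiv hf (Equiv.neg ℤ) h

theorem hasSum_odd_iff {f : ℤ → ℂ} {s : ℂ} :
    HasSum (fun m : ℤ => if Odd m then f m else 0) s ↔ HasSum (fun m : ℤ => f (2 * m + 1)) s := by
  have hinj : Function.Injective fun m : ℤ => 2 * m + 1 := fun a b h => by
    simp only at h; omega
  rw [← hinj.hasSum_iff (f := fun m : ℤ => if Odd m then f m else 0)]
  · refine iff_of_eq (congrArg (HasSum · s) (funext fun m => ?_))
    simp
  · intro x hx
    refine if_neg fun ⟨k, hk⟩ => hx ⟨k, hk.symm⟩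

/-- The integers of a fixed parity are represented by the naturals modulo `l ↦ -1 - l`. -/
def halfEquiv (p : ℤ) : ℤ ≃ ℕ where
  toFun m := if 0 ≤ 2 * m + p then (2 * m + p).toNat else (-1 - (2 * m + p)).toNat
  invFun l := if ((l : ℤ) - p) % 2 = 0 then ((l : ℤ) - p) / 2 else (-1 - (l : ℤ) - p) / 2
  left_inv m := by
    simp only
    split_ifs <;> omega
  right_inv l := by
    simp only
    split_ifs <;> omega

/-- The reflection l ↦ -1-l exchanges the parities and also the nonnegative with the negative
integers, so the integers of one parity and the naturals carry the same values of g. -/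
theorem hasSum_half {g : ℤ → ℂ} {s : ℂ} (hg : ∀ l, g (-1 - l) = g l)
    (hs : HasSum (fun l : ℕ => g l) s) (p : ℤ) : HasSum (fun m : ℤ => g (2 * m + p)) s := by
  rw [← (halfEquiv p).hasSum_iff] at hs
  refine hasSum_of_eq hs (fun m => ?_) rfl
  simp only [Function.comp_def, halfEquiv, Equiv.coe_fn_mk]
  split_ifs with h
  · rw [Int.toNat_of_nonneg h]
  · rw [Int.toNat_of_nonneg (by omega), hg]

/-- Summation of the theta-like differences of `∑ A(m) cosech(m) q^{-2nm}`. -/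
theorem hasSum_telescope {q : ℂ} (hq0 : q ≠ 0) (hq : ‖q‖ < 1) {A : ℤ → ℂ}
    (hA : ∀ m, A (-m) = A m) (hs : Summable fun m => A m * cosech q m) {B : ℕ → ℂ}
    (hB : ∀ j : ℕ, HasSum (fun m : ℤ => A m * q ^ (-((2 * j + 1) * m))) (B j)) (n : ℕ) :
    HasSum (fun m : ℤ => A m * cosech q m * q ^ (-(2 * n * m)))
      (∑ j ∈ range n, B j - n * A 0) := by
  induction n with
  | zero =>
    simp only [Nat.cast_zero, mul_zero, zero_mul, neg_zero, zpow_zero, mul_one, range_zero,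
      sum_empty, sub_zero]
    exact hasSum_zero_of_odd hs fun m => by rw [hA, cosech_neg hq0, mul_neg]
  | succ n ih =>
    -- Raising n by one adds A(m) q^{-(2n+1)m} to the summand for m ≠ 0. At m = 0 nothing is added
    -- since `cosech` vanishes there, so the term A(0) of the theta series is taken off.
    have h := (ih.add (hB n)).sub (hasSum_ite_eq (0 : ℤ) (A 0))
    refine hasSum_of_eq h (fun m => ?_) ?_
    · split_ifs with hm
      · subst hm; simp
      · have h1 := one_sub_zpow_ne_zero hq (m := 2 * m) (by omega)
        have e1 : q ^ (-(2 * ((n + 1 : ℕ) : ℤ) * m)) = q ^ (-(2 * n * m)) * (q ^ (2 * m))⁻¹ := by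
          rw [← zpow_neg, ← zpow_add₀ hq0]; congr 1; push_cast; ring
        have e2 : q ^ (-((2 * n + 1) * m)) = q ^ (-(2 * n * m)) * (q ^ m)⁻¹ := by
          rw [← zpow_neg, ← zpow_add₀ hq0]; congr 1; ring
        have e3 : q ^ (2 * m) = (q ^ m) ^ 2 := by rw [two_mul, zpow_add₀ hq0, sq]
        have hm0 : q ^ m ≠ 0 := zpow_ne_zero _ hq0
        rw [e1, e2, cosech]
        rw [e3] at h1 ⊢
        field_simp
        ring
    · rw [sum_range_succ]; push_cast; ring

/-! ### Theta series and the two expansions in shifted squares -/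

/-- The triangular number `l (l + 1) / 2` of an integer. -/
def tri (l : ℤ) : ℤ := l * (l + 1) / 2

theorem two_mul_tri (l : ℤ) : 2 * tri l = l * (l + 1) :=
  Int.mul_ediv_cancel' (Int.even_mul_succ_self l).two_dvd

theorem tri_eq {l t : ℤ} (h : 2 * t = l * (l + 1)) : tri l = t := by
  have := two_mul_tri l
  omega

theorem tri_natCast (s : ℕ) : ((s * (s + 1) / 2 : ℕ) : ℤ) = tri s := by
  rw [tri]; push_cast; rfl

theorem tri_reflect (l : ℤ) : tri (-1 - l) = tri l :=
  tri_eq (by rw [two_mul_tri]; ring)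

theorem norm_neg_one_zpow (m : ℤ) : ‖(-1 : ℂ) ^ m‖ = 1 := by
  rw [norm_zpow]; simp

section

variable {q : ℂ}

theorem summable_norm_cosech (hq0 : q ≠ 0) (hq : ‖q‖ < 1) : Summable fun m => ‖cosech q m‖ :=
  Summable.of_nonneg_of_le (fun _ => norm_nonneg _) (norm_cosech_le hq0 hq)
    ((summable_pow_natAbs (norm_nonneg q) hq).mul_left _)

theorem norm_sq_le_one (hq : ‖q‖ < 1) (m : ℤ) : ‖q ^ (m ^ 2)‖ ≤ 1 := by
  rw [← Int.natAbs_sq, ← Nat.cast_pow, zpow_natCast, norm_pow]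
  exact pow_le_one₀ (norm_nonneg _) hq.le

/-- The even weight `q^{m²} - (-1)^m`. -/
noncomputable def thetaWeight (q : ℂ) (m : ℤ) : ℂ := q ^ (m ^ 2) - (-1) ^ m

theorem thetaWeight_neg (m : ℤ) : thetaWeight q (-m) = thetaWeight q m := by
  rw [thetaWeight, thetaWeight, neg_sq, zpow_neg, ← inv_zpow, inv_neg, inv_one]

theorem norm_thetaWeight_le (hq : ‖q‖ < 1) (m : ℤ) : ‖thetaWeight q m‖ ≤ 2 := by
  refine (norm_sub_le _ _).trans ?_
  rw [norm_neg_one_zpow]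
  linarith [norm_sq_le_one hq m]

/-- The substitution m ↦ 2j+1-m preserves the exponent and reverses the sign. -/
theorem hasSum_theta_alternating (hq0 : q ≠ 0) (hq : ‖q‖ < 1) (j : ℕ) :
    HasSum (fun m : ℤ => (-1) ^ m * q ^ (m ^ 2 - (2 * j + 1) * m)) 0 := by
  have hs : Summable fun m : ℤ => (-1 : ℂ) ^ m * q ^ (m ^ 2 - (2 * j + 1) * m) := by
    refine Summable.of_norm ?_
    simp only [norm_mul, norm_neg_one_zpow, one_mul]
    refine summable_norm_zpow hq0 hq _ ((|-(2 * (j : ℤ) + 1)| + 1) ^ 2) fun m => ?_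
    rw [sub_eq_add_neg (m ^ 2), ← neg_mul]
    exact abs_sub_le_sq_add m _
  refine hasSum_zero_of_equiv hs (Equiv.subLeft (2 * (j : ℤ) + 1)) fun m => ?_
  simp only [Equiv.subLeft_apply]
  rw [show (2 * (j : ℤ) + 1 - m) ^ 2 - (2 * j + 1) * (2 * j + 1 - m) = m ^ 2 - (2 * j + 1) * m by
    ring, zpow_sub₀ (by norm_num), Odd.neg_one_zpow ⟨(j : ℤ), rfl⟩, div_eq_mul_inv,
    ← inv_zpow, inv_neg, inv_one, neg_one_mul, neg_mul]

theorem hasSum_tri_half {ψ : ℂ} (hψ : HasSum (fun s : ℕ => q ^ (s * (s + 1) / 2)) ψ) (p : ℤ) :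
    HasSum (fun m : ℤ => q ^ tri (2 * m + p)) ψ := by
  refine hasSum_half (g := fun l => q ^ tri l) (fun l => by simp only [tri_reflect]) ?_ p
  simpa only [← tri_natCast, zpow_natCast] using hψ

/-- Completing the square: 2m² - (2j+1)m = tri(2m-j-1) - tri(j), and one parity class already
carries all of ψ. -/
theorem hasSum_theta_triangular (hq0 : q ≠ 0) {ψ : ℂ}
    (hψ : HasSum (fun s : ℕ => q ^ (s * (s + 1) / 2)) ψ) (j : ℕ) :
    HasSum (fun m : ℤ => q ^ (2 * m ^ 2 - (2 * j + 1) * m)) (q ^ (-tri j) * ψ) := by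
  have h2 := (hasSum_tri_half hψ (-(j : ℤ) - 1)).mul_left (q ^ (-tri j))
  refine hasSum_of_eq h2 (fun m => ?_) rfl
  rw [← zpow_add₀ hq0]
  congr 1
  have h3 := two_mul_tri j
  have h4 := two_mul_tri (2 * m + (-(j : ℤ) - 1))
  refine mul_left_cancel₀ two_ne_zero ?_
  linear_combination h3 - h4

theorem hasSum_oblong_half {ψ₂ : ℂ} (hψ : HasSum (fun s : ℕ => q ^ (s * (s + 1))) ψ₂) (p : ℤ) :
    HasSum (fun m : ℤ => q ^ ((2 * m + p) * (2 * m + p + 1))) ψ₂ := by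
  refine hasSum_half (g := fun l => q ^ (l * (l + 1))) (fun l => ?_) ?_ p
  · congr 1
    ring
  · refine hasSum_of_eq hψ (fun s => ?_) rfl
    exact_mod_cast zpow_natCast q (s * (s + 1))

/-- The first expansion: `cosech(m) (q^{m²} - (-1)^m)` against `q^{(n-m)²}`. -/
theorem hasSum_triangular_expansion (hq0 : q ≠ 0) (hq : ‖q‖ < 1) {ψ : ℂ}
    (hψ : HasSum (fun s : ℕ => q ^ (s * (s + 1) / 2)) ψ) (n : ℕ) :
    HasSum (fun m : ℤ => cosech q m * thetaWeight q m * q ^ ((n - m) ^ 2))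
      (ψ * (q ^ ((n : ℤ) ^ 2) * ∑ j ∈ range n, q ^ (-tri j))) := by
  have h := hasSum_telescope hq0 hq (A := fun m => q ^ (m ^ 2) * thetaWeight q m)
    (fun m => by rw [thetaWeight_neg, neg_sq]) (by
      refine Summable.of_norm_bounded ((summable_norm_cosech hq0 hq).mul_left 2) fun m => ?_
      rw [norm_mul, norm_mul]
      have h1 := norm_sq_le_one hq m
      have h2 := norm_thetaWeight_le hq m
      have h3 : ‖q ^ (m ^ 2)‖ * ‖thetaWeight q m‖ ≤ 1 * 2 := by gcongr
      rw [one_mul] at h3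
      gcongr)
    (B := fun j => q ^ (-tri j) * ψ) (fun j => by
      refine hasSum_of_eq ((hasSum_theta_triangular hq0 hψ j).sub
        (hasSum_theta_alternating hq0 hq j)) (fun m => ?_) (sub_zero _).symm
      rw [thetaWeight, mul_sub, sub_mul, ← zpow_add₀ hq0, ← zpow_add₀ hq0, mul_right_comm,
        ← zpow_add₀ hq0, mul_comm (q ^ _) ((-1) ^ m)]
      congr 3
      all_goals ring) n
  refine hasSum_of_eq (h.mul_left (q ^ ((n : ℤ) ^ 2))) (fun m => ?_) ?_
  · rw [show ((n : ℤ) - m) ^ 2 = n ^ 2 + m ^ 2 + -(2 * n * m) by ring, zpow_add₀ hq0,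
      zpow_add₀ hq0]
    ring
  -- The weight vanishes at 0, so the telescoping leaves no multiple of n.
  · simp only [thetaWeight, ← sum_mul]
    norm_num
    ring

/-- For odd x, x² - (2k+1)x = (x-1-k)(x-k) - k(k+1), where x-1-k runs over one parity class. -/
theorem hasSum_theta_oblong (hq0 : q ≠ 0) {ψ₂ : ℂ}
    (hψ : HasSum (fun s : ℕ => q ^ (s * (s + 1))) ψ₂) (k : ℕ) :
    HasSum (fun m : ℤ => (if Odd m then q ^ (m ^ 2) else 0) * q ^ (-((2 * k + 1) * m)))
      (q ^ (-((k : ℤ) * (k + 1))) * ψ₂) := by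
  have h2 := (hasSum_oblong_half hψ (-(k : ℤ))).mul_left (q ^ (-((k : ℤ) * (k + 1))))
  have h3 : HasSum (fun m : ℤ => q ^ ((2 * m + 1) ^ 2 + -((2 * (k : ℤ) + 1) * (2 * m + 1))))
      (q ^ (-((k : ℤ) * (k + 1))) * ψ₂) := by
    refine hasSum_of_eq h2 (fun m => ?_) rfl
    rw [← zpow_add₀ hq0]
    congr 1
    ring
  have h4 := (hasSum_odd_iff (f := fun m : ℤ => q ^ (m ^ 2 + -((2 * (k : ℤ) + 1) * m)))).mpr h3
  refine hasSum_of_eq h4 (fun m => ?_) rfl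
  simp only [ite_mul, zero_mul, zpow_add₀ hq0]

/-- The second expansion: `cosech(m)` at odd `m` against `q^{(n-m)²}`. -/
theorem hasSum_oblong_expansion (hq0 : q ≠ 0) (hq : ‖q‖ < 1) {ψ₂ : ℂ}
    (hψ : HasSum (fun s : ℕ => q ^ (s * (s + 1))) ψ₂) (n : ℕ) :
    HasSum (fun m : ℤ => (if Odd m then cosech q m else 0) * q ^ ((n - m) ^ 2))
      (ψ₂ * (q ^ ((n : ℤ) ^ 2) * ∑ k ∈ range n, q ^ (-((k : ℤ) * (k + 1))))) := by
  have h := hasSum_telescope hq0 hq (A := fun m => if Odd m then q ^ (m ^ 2) else 0)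
    (fun m => by rw [neg_sq]; simp only [odd_neg]) (by
      refine Summable.of_norm_bounded (summable_norm_cosech hq0 hq) fun m => ?_
      rw [norm_mul]
      refine mul_le_of_le_one_left (norm_nonneg _) ?_
      split_ifs
      · exact norm_sq_le_one hq m
      · simp)
    (hasSum_theta_oblong hq0 hψ) n
  refine hasSum_of_eq (h.mul_left (q ^ ((n : ℤ) ^ 2))) (fun m => ?_) ?_
  · rw [show ((n : ℤ) - m) ^ 2 = n ^ 2 + m ^ 2 + -(2 * n * m) by ring, zpow_add₀ hq0,
      zpow_add₀ hq0]
    split_ifs <;> ring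
  · simp only [← sum_mul]
    norm_num
    ring

/-- The bijection `(m, y) ↦ (y, y + m)`. -/
def shearEquiv : ℤ × ℤ ≃ ℤ × ℤ where
  toFun x := (x.2, x.2 + x.1)
  invFun x := (x.2 - x.1, x.1)
  left_inv x := by ext <;> simp
  right_inv x := by ext <;> simp

/-- For fixed m, the last product runs over the oblong numbers of one parity class as y varies; this
separates φ from ψ₂ in ψ². -/
theorem tri_add_tri (m y : ℤ) :
    tri (2 * y) + tri (2 * (y + m)) = m ^ 2 + (2 * y + m) * (2 * y + m + 1) := by
  refine mul_left_cancel₀ (two_ne_zero : (2 : ℤ) ≠ 0) ?_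
  linear_combination two_mul_tri (2 * y) + two_mul_tri (2 * (y + m))

/-- `ψ(q)² = φ(q) ψ(q²)`. -/
theorem psi_sq_eq (hq0 : q ≠ 0) {ψ ψ₂ φ : ℂ}
    (hψ : HasSum (fun s : ℕ => q ^ (s * (s + 1) / 2)) ψ)
    (hψ₂ : HasSum (fun s : ℕ => q ^ (s * (s + 1))) ψ₂)
    (hφ : HasSum (fun m : ℤ => q ^ (m ^ 2)) φ) : ψ * ψ = φ * ψ₂ := by
  have hz : HasSum (fun m : ℤ => q ^ tri (2 * m)) ψ := by
    simpa only [add_zero] using hasSum_tri_half hψ 0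
  have hp : HasSum (fun x : ℤ × ℤ => q ^ tri (2 * x.1) * q ^ tri (2 * x.2)) (ψ * ψ) :=
    hasSum_mul (f := fun m : ℤ => q ^ tri (2 * m)) (g := fun m : ℤ => q ^ tri (2 * m)) hz hz
  have h2 : HasSum (fun x : ℤ × ℤ => q ^ (x.1 ^ 2) * q ^ ((2 * x.2 + x.1) * (2 * x.2 + x.1 + 1)))
      (ψ * ψ) := by
    refine hasSum_of_eq (shearEquiv.hasSum_iff.mpr hp) (fun x => ?_) rfl
    rw [← zpow_add₀ hq0, ← tri_add_tri, zpow_add₀ hq0]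
    rfl
  have h3 : HasSum (fun m : ℤ => q ^ (m ^ 2) * ψ₂) (ψ * ψ) :=
    h2.prod_fiberwise fun m => (hasSum_oblong_half hψ₂ m).mul_left (q ^ (m ^ 2))
  exact h3.unique (hφ.mul_right ψ₂)

end

/-! ### Weighting the expansions: the triangular and the Kronecker relation -/

/-- The bijection `(n, m) ↦ (n - m, m)`. -/
def subEquiv : ℤ × ℤ ≃ ℤ × ℤ where
  toFun x := (x.1 - x.2, x.2)
  invFun x := (x.1 + x.2, x.2)
  left_inv x := by ext <;> simp
  right_inv x := by ext <;> simp

section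

variable {q : ℂ}

/-- An expansion in the shifted squares, known at the naturals, holds at the negative integers
with the opposite sign, if the coefficients are odd. -/
theorem hasSum_expansion_neg {a : ℤ → ℂ} (ha : ∀ m, a (-m) = -a m) {n : ℤ} {b : ℂ}
    (h : HasSum (fun m : ℤ => a m * q ^ ((n - m) ^ 2)) b) :
    HasSum (fun m : ℤ => a m * q ^ ((-n - m) ^ 2)) (-b) := by
  have h1 : HasSum (fun m : ℤ => a (-m) * q ^ ((n - -m) ^ 2)) b :=
    hasSum_equiv (Equiv.neg ℤ) h fun m => rfl
  refine hasSum_of_eq h1.neg (fun m => ?_) rfl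
  rw [ha, show (n - -m) ^ 2 = (-n - m) ^ 2 by ring]
  ring

theorem exists_expansion_int {a : ℤ → ℂ} (ha : ∀ m, a (-m) = -a m) {b : ℕ → ℂ}
    (h : ∀ n : ℕ, HasSum (fun m : ℤ => a m * q ^ ((n - m) ^ 2)) (b n)) :
    ∃ b' : ℤ → ℂ, (∀ n : ℤ, HasSum (fun m : ℤ => a m * q ^ ((n - m) ^ 2)) (b' n)) ∧
      (∀ n : ℕ, b' n = b n) ∧ ∀ n : ℕ, b' (-n) = -b n := by
  have hs : ∀ n : ℤ, Summable fun m : ℤ => a m * q ^ ((n - m) ^ 2) := by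
    intro n
    obtain ⟨k, rfl | rfl⟩ := n.eq_nat_or_neg
    · exact (h k).summable
    · exact (hasSum_expansion_neg ha (h k)).summable
  exact ⟨fun n => ∑' m : ℤ, a m * q ^ ((n - m) ^ 2), fun n => (hs n).hasSum,
    fun n => (h n).tsum_eq, fun n => (hasSum_expansion_neg ha (h n)).tsum_eq⟩

theorem hasSum_int_mul_sq (hq0 : q ≠ 0) (hq : ‖q‖ < 1) :
    HasSum (fun r : ℤ => r * q ^ (r ^ 2)) 0 := by
  refine hasSum_zero_of_odd (Summable.of_norm_bounded
    ((summable_natAbs_mul_pow (norm_nonneg q) hq).mul_left (‖q‖ ^ (-(0 : ℤ)))) fun r => ?_)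
    fun m => by rw [neg_sq]; push_cast; ring
  rw [norm_mul, mul_left_comm]
  have h1 := norm_zpow_le hq0 hq (abs_le_sq r)
  have h2 : ‖((r : ℤ) : ℂ)‖ = r.natAbs := by
    rw [Complex.norm_intCast, Nat.cast_natAbs, Int.cast_abs]
  rw [h2]
  gcongr

/-- With r = n-m the weight n is r+m. The part with r contributes (∑ r q^{r²})(∑ a) = 0 and the part
with m contributes φM; folding n with -n gives the factor 2. -/
theorem hasSum_nat_mul_expansion (hq0 : q ≠ 0) (hq : ‖q‖ < 1) {a : ℤ → ℂ}
    (ha : ∀ m, a (-m) = -a m) (has : Summable a) {b : ℕ → ℂ}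
    (h : ∀ n : ℕ, HasSum (fun m : ℤ => a m * q ^ ((n - m) ^ 2)) (b n)) {φ M : ℂ}
    (hφ : HasSum (fun m : ℤ => q ^ (m ^ 2)) φ) (hM : HasSum (fun m : ℤ => m * a m) M) :
    HasSum (fun n : ℕ => 2 * (n * b n)) (φ * M) := by
  obtain ⟨b', hb', hbn, hbneg⟩ := exists_expansion_int ha h
  have h1 := hasSum_mul (f := fun r : ℤ => r * q ^ (r ^ 2)) (g := a)
    (hasSum_int_mul_sq hq0 hq) (hasSum_zero_of_odd has ha)
  have h2 := hasSum_mul (f := fun r : ℤ => q ^ (r ^ 2)) (g := fun m : ℤ => m * a m) hφ hM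
  have h3 : HasSum (fun x : ℤ × ℤ => (x.1 : ℂ) * (a x.2 * q ^ ((x.1 - x.2) ^ 2))) (φ * M) := by
    rw [show φ * M = 0 * 0 + φ * M by ring]
    refine hasSum_equiv subEquiv (h1.add h2) fun x => ?_
    simp only [subEquiv, Equiv.coe_fn_mk]
    push_cast
    ring
  have h4 : HasSum (fun n : ℤ => n * b' n) (φ * M) :=
    h3.prod_fiberwise fun n => (hb' n).mul_left _
  refine hasSum_of_eq h4.nat_add_neg (fun n => ?_) (by simp)
  rw [hbn, hbneg]
  push_cast
  ring

theorem norm_cosech_thetaWeight_le (hq0 : q ≠ 0) (hq : ‖q‖ < 1) (m : ℤ) :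
    ‖cosech q m * thetaWeight q m‖ ≤ 2 * (1 / (1 - ‖q‖)) * ‖q‖ ^ m.natAbs := by
  rw [norm_mul, mul_assoc 2, mul_comm]
  have h1 := norm_thetaWeight_le hq m
  have h2 := norm_cosech_le hq0 hq m
  gcongr

theorem summable_int_mul_thetaWeight (hq0 : q ≠ 0) (hq : ‖q‖ < 1) :
    Summable fun m : ℤ => m * (cosech q m * thetaWeight q m) := by
  refine Summable.of_norm_bounded
    ((summable_natAbs_mul_pow (norm_nonneg q) hq).mul_left (2 * (1 / (1 - ‖q‖)))) fun m => ?_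
  rw [norm_mul, mul_left_comm, Complex.norm_intCast, Nat.cast_natAbs, Int.cast_abs]
  exact mul_le_mul_of_nonneg_left (norm_cosech_thetaWeight_le hq0 hq m) (abs_nonneg _)

/-- The triangular relation. -/
theorem hasSum_nat_mul_triangular (hq0 : q ≠ 0) (hq : ‖q‖ < 1) {ψ φ : ℂ}
    (hψ : HasSum (fun s : ℕ => q ^ (s * (s + 1) / 2)) ψ)
    (hφ : HasSum (fun m : ℤ => q ^ (m ^ 2)) φ) :
    HasSum (fun n : ℕ => 2 * (n * (ψ * (q ^ ((n : ℤ) ^ 2) * ∑ j ∈ range n, q ^ (-tri j)))))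
      (φ * ∑' m : ℤ, m * (cosech q m * thetaWeight q m)) := by
  refine hasSum_nat_mul_expansion hq0 hq (a := fun m => cosech q m * thetaWeight q m)
    (fun m => ?_) ?_ (hasSum_triangular_expansion hq0 hq hψ) hφ
    (summable_int_mul_thetaWeight hq0 hq).hasSum
  · rw [cosech_neg hq0, thetaWeight_neg, neg_mul]
  · exact Summable.of_norm_bounded ((summable_pow_natAbs (norm_nonneg q) hq).mul_left _)
      (norm_cosech_thetaWeight_le hq0 hq)

/-- The addition theorem of the hyperbolic functions. -/
theorem cotanh_mul_cosech (hq0 : q ≠ 0) (hq : ‖q‖ < 1) {m r : ℤ} (hm : m ≠ 0) (hr : r ≠ 0)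
    (hmr : r + m ≠ 0) : cotanh q (r + m) * cosech q m =
      cotanh q r * cosech q m - 2 * cosech q r * cosech q (r + m) := by
  have h1 := one_sub_zpow_ne_zero hq (m := 2 * m) (by omega)
  have h2 := one_sub_zpow_ne_zero hq (m := 2 * r) (by omega)
  have h3 := one_sub_zpow_ne_zero hq (m := 2 * (r + m)) (by omega)
  have e1 : q ^ (2 * m) = (q ^ m) ^ 2 := by rw [two_mul, zpow_add₀ hq0, sq]
  have e2 : q ^ (2 * r) = (q ^ r) ^ 2 := by rw [two_mul, zpow_add₀ hq0, sq]
  have e3 : q ^ (2 * (r + m)) = (q ^ r * q ^ m) ^ 2 := by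
    rw [two_mul, zpow_add₀ hq0, zpow_add₀ hq0, sq]
  simp only [cotanh, cosech, zpow_add₀ hq0 r m]
  rw [e1] at h1 ⊢
  rw [e2] at h2 ⊢
  rw [e3, mul_pow] at h3
  rw [e3, mul_pow]
  field_simp
  ring

theorem summable_norm_odd_cosech (hq0 : q ≠ 0) (hq : ‖q‖ < 1) (r : ℤ) :
    Summable fun m : ℤ => ‖if Odd (m - r) then cosech q m else 0‖ := by
  refine Summable.of_nonneg_of_le (fun _ => norm_nonneg _) (fun m => ?_)
    (summable_norm_cosech hq0 hq)
  split_ifs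
  · exact le_rfl
  · simp

theorem hasSum_odd_cosech (hq0 : q ≠ 0) (hq : ‖q‖ < 1) (r : ℤ) :
    HasSum (fun m : ℤ => if Odd (m - r) then cosech q m else 0) 0 := by
  refine hasSum_zero_of_odd (summable_norm_odd_cosech hq0 hq r).of_norm fun m => ?_
  have : Odd (-m - r) ↔ Odd (m - r) := by
    rw [Int.odd_iff, Int.odd_iff]; omega
  rw [if_congr this rfl rfl]
  split_ifs
  · exact cosech_neg hq0 m
  · simp

/-- After the addition theorem both remaining sums over m vanish by oddness. The only contribution
is at m = -r, where `cotanh` and `cosech` take the default value 0 and the addition theorem needs a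
correction. -/
theorem hasSum_cotanh_cosech_of_ne (hq0 : q ≠ 0) (hq : ‖q‖ < 1) {r : ℤ} (hr : r ≠ 0) :
    HasSum (fun m : ℤ => cotanh q (r + m) * if Odd m then cosech q m else 0)
      (if Odd r then cotanh q r * cosech q r else 0) := by
  have h1 := (hasSum_odd_cosech hq0 hq 0).mul_left (cotanh q r)
  have h2 : HasSum (fun m : ℤ => if Odd m then cosech q (r + m) else 0) 0 := by
    refine hasSum_equiv (Equiv.addLeft r) (hasSum_odd_cosech hq0 hq r) fun m => ?_
    rw [Equiv.coe_addLeft, add_sub_cancel_left]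
  have h3 := (h1.sub (h2.mul_left (2 * cosech q r))).add
    (hasSum_ite_eq (-r) (if Odd r then cotanh q r * cosech q r else 0))
  refine hasSum_of_eq h3 (fun m => ?_) (by ring)
  rw [sub_zero]
  by_cases ho : Odd m
  · have hm : m ≠ 0 := by rintro rfl; simp at ho
    simp only [if_pos ho]
    split_ifs with h4 h5
    · subst h4; rw [add_neg_cancel, cotanh_zero, cosech_zero, cosech_neg hq0]; ring
    · subst h4; exact absurd (odd_neg.mp ho) h5
    · rw [cotanh_mul_cosech hq0 hq hm hr (by omega), add_zero]
  · simp only [if_neg ho, mul_zero, sub_zero, zero_add]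
    by_cases h4 : m = -r
    · rw [if_pos h4, if_neg fun h5 => ho (by rw [h4]; exact odd_neg.mpr h5)]
    · rw [if_neg h4]

theorem summable_odd_cotanh_cosech (hq0 : q ≠ 0) (hq : ‖q‖ < 1) :
    Summable fun m : ℤ => if Odd m then cotanh q m * cosech q m else 0 := by
  refine Summable.of_norm_bounded ((summable_norm_cosech hq0 hq).mul_left (2 / (1 - ‖q‖)))
    fun m => ?_
  split_ifs
  · rw [norm_mul]
    exact mul_le_mul_of_nonneg_right (norm_cotanh_le hq0 hq m) (norm_nonneg _)
  · rw [norm_zero]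
    have : 0 < 1 - ‖q‖ := by linarith
    positivity

theorem neg_one_zpow_sub_odd {n m : ℤ} (hm : Odd m) : (-1 : ℂ) ^ (n - m) = -(-1) ^ n := by
  rw [zpow_sub₀ (by norm_num), hm.neg_one_zpow, div_neg, div_one]

/-- The class number relation of Kronecker type. -/
theorem hasSum_kronecker_relation (hq0 : q ≠ 0) (hq : ‖q‖ < 1) {b : ℕ → ℂ}
    (h : ∀ n : ℕ, HasSum (fun m : ℤ => (if Odd m then cosech q m else 0) * q ^ ((n - m) ^ 2))
      (b n)) :
    HasSum (fun n : ℕ => 2 * ((-1) ^ (n + 1) * cotanh q n * b n))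
      (∑' m : ℤ, if Odd m then (1 - q ^ (m ^ 2)) * (cotanh q m * cosech q m) else 0) := by
  obtain ⟨b', hb', hbn, hbneg⟩ := exists_expansion_int (fun m => by
    rw [if_congr odd_neg rfl rfl]
    split_ifs
    · exact cosech_neg hq0 m
    · simp) h
  let a : ℤ → ℂ := fun m => if Odd m then cosech q m else 0
  -- Summed over m for fixed r, this double series collapses to the right-hand side; summed along n
  -- = r+m, it gives the expansion coefficients weighted by cotanh(n).
  let F : ℤ × ℤ → ℂ := fun x => (-1) ^ x.1 * q ^ (x.1 ^ 2) * (cotanh q (x.1 + x.2) * a x.2)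
  have ha : Summable fun m => ‖a m‖ := by simpa using summable_norm_odd_cosech hq0 hq 0
  have hF : Summable F := by
    have h1 := ((summable_norm_sq hq0 hq).mul_of_nonneg ha (fun _ => norm_nonneg _)
      (fun _ => norm_nonneg _)).mul_left (2 / (1 - ‖q‖))
    refine Summable.of_norm_bounded h1 fun x => ?_
    simp only [F, norm_mul, norm_neg_one_zpow, one_mul]
    calc _ ≤ ‖q ^ (x.1 ^ 2)‖ * (2 / (1 - ‖q‖) * ‖a x.2‖) := by
          gcongr
          exact norm_cotanh_le hq0 hq _
      _ = _ := by ring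
  have hrow : HasSum (fun r : ℤ => (if r = 0 then ∑' m : ℤ,
      (if Odd m then cotanh q m * cosech q m else 0) else 0) -
      (if Odd r then q ^ (r ^ 2) * (cotanh q r * cosech q r) else 0)) (∑' x, F x) := by
    refine hF.hasSum.prod_fiberwise fun r => ?_
    rcases eq_or_ne r 0 with rfl | hr
    · refine hasSum_of_eq (summable_odd_cotanh_cosech hq0 hq).hasSum (fun m => ?_) (by simp)
      simp only [F, a, zpow_zero, one_mul, zero_add, ne_eq, OfNat.ofNat_ne_zero, not_false_eq_true,
        zero_pow, mul_ite, mul_zero]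
    · refine hasSum_of_eq ((hasSum_cotanh_cosech_of_ne hq0 hq hr).mul_left
        ((-1) ^ r * q ^ (r ^ 2))) (fun m => rfl) ?_
      rw [if_neg hr]
      split_ifs with ho
      · rw [ho.neg_one_zpow]; ring
      · ring
  have hE : Summable fun r : ℤ => if Odd r then q ^ (r ^ 2) * (cotanh q r * cosech q r) else 0 := by
    refine Summable.of_norm_bounded (summable_odd_cotanh_cosech hq0 hq).norm fun r => ?_
    split_ifs
    · rw [norm_mul]
      exact mul_le_of_le_one_left (norm_nonneg _) (norm_sq_le_one hq r)
    · exact le_rfl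
  have hval : ∑' x, F x =
      ∑' m : ℤ, if Odd m then (1 - q ^ (m ^ 2)) * (cotanh q m * cosech q m) else 0 := by
    rw [hrow.unique ((hasSum_ite_eq 0 _).sub hE.hasSum),
      ← (summable_odd_cotanh_cosech hq0 hq).tsum_sub hE]
    refine tsum_congr fun m => ?_
    split_ifs <;> ring
  have hcol : HasSum (fun n : ℤ => -((-1) ^ n * cotanh q n * b' n)) (∑' x, F x) := by
    have hG : HasSum (fun x : ℤ × ℤ => F (x.1 - x.2, x.2)) (∑' x, F x) :=
      hasSum_equiv subEquiv hF.hasSum fun _ => rfl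
    refine hG.prod_fiberwise fun n => ?_
    -- Only odd m contribute, so (-1)^{n-m} = -(-1)ⁿ leaves the sum.
    refine hasSum_of_eq ((hb' n).mul_left (-((-1) ^ n * cotanh q n))) (fun m => ?_) (by ring)
    simp only [F, a, sub_add_cancel]
    split_ifs with ho
    · rw [neg_one_zpow_sub_odd ho]; ring
    · ring
  rw [← hval]
  refine hasSum_of_eq hcol.nat_add_neg (fun n => ?_) (by simp)
  rw [hbn, hbneg, cotanh_neg hq0, zpow_neg, ← inv_zpow, inv_neg, inv_one, zpow_natCast, pow_succ]
  ring

end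

/-! ### The Lambert series identity -/

/-- `(x, y) ↦ (x, x + y)` or `(x + y, x)`, whichever starts with an even number, on the pairs
`x = i + 1`, `y = 2j + 1`; the image is written as `(2i + 2, 2j + 1)`. -/
def minDiffEquiv : ℕ × ℕ ≃ ℕ × ℕ where
  toFun p := if p.1 % 2 = 0 then ((p.1 + 2 * p.2) / 2, p.1 / 2)
    else (p.1 / 2, (p.1 + 1 + 2 * p.2) / 2)
  invFun p := if p.2 ≤ p.1 then (2 * p.2, p.1 - p.2) else (2 * p.1 + 1, p.2 - p.1 - 1)
  left_inv p := by
    obtain ⟨i, j⟩ := p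
    simp only
    split_ifs <;> simp only [Prod.mk.injEq] at * <;> omega
  right_inv p := by
    obtain ⟨i, j⟩ := p
    simp only
    split_ifs <;> simp only [Prod.mk.injEq] at * <;> omega

section

variable {q : ℂ}

theorem summable_lambert (hq : ‖q‖ < 1) :
    Summable fun p : ℕ × ℕ => (p.1 + p.2 + 1 : ℝ) * ‖q‖ ^ (p.1 + p.2) := by
  have h0 : Summable fun n : ℕ => ‖q‖ ^ n := summable_geometric_of_lt_one (norm_nonneg q) hq
  have h1 : Summable fun n : ℕ => (n : ℝ) * ‖q‖ ^ n := by
    simpa using summable_pow_mul_geometric_of_norm_lt_one 1 (r := ‖q‖) (by rwa [norm_norm])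
  have z0 : 0 ≤ fun n : ℕ => ‖q‖ ^ n := fun n => by positivity
  have z1 : 0 ≤ fun n : ℕ => (n : ℝ) * ‖q‖ ^ n := fun n => by positivity
  refine (((h1.mul_of_nonneg h0 z1 z0).add (h0.mul_of_nonneg h1 z0 z1)).add
    (h0.mul_of_nonneg h0 z0 z0)).congr fun p => ?_
  rw [pow_add]
  ring

theorem summable_of_lambert_bound (hq : ‖q‖ < 1) {f : ℕ × ℕ → ℂ} (C : ℝ)
    (h : ∀ i j : ℕ, ‖f (i, j)‖ ≤ C * ((i + j + 1) * ‖q‖ ^ (i + j))) : Summable f :=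
  Summable.of_norm_bounded ((summable_lambert hq).mul_left C) fun p => h p.1 p.2

theorem norm_natCast_mul_pow_le (hq : ‖q‖ < 1) {c e i j : ℕ} (hc : c ≤ 2 * (i + j + 1))
    (he : i + j ≤ e) : ‖(c : ℂ) * q ^ e‖ ≤ 2 * ((i + j + 1) * ‖q‖ ^ (i + j)) := by
  rw [norm_mul, norm_pow, Complex.norm_natCast, ← mul_assoc]
  have h1 := pow_le_pow_of_le_one (norm_nonneg q) hq.le he
  have h2 : (c : ℝ) ≤ 2 * (i + j + 1) := by exact_mod_cast hc
  gcongr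

/-- Sums over the even first coordinates. -/
theorem hasSum_even_fst {f : ℕ → ℕ → ℂ} {s : ℂ}
    (h : HasSum (fun p : ℕ × ℕ => f (2 * p.1 + 2) p.2) s) :
    HasSum (fun p : ℕ × ℕ => if Even (p.1 + 1) then f (p.1 + 1) p.2 else 0) s := by
  have hinj : Function.Injective fun p : ℕ × ℕ => (2 * p.1 + 1, p.2) := by
    rintro ⟨a, b⟩ ⟨c, d⟩ h
    simp only [Prod.mk.injEq] at h ⊢
    omega
  rw [← hinj.hasSum_iff]
  · refine hasSum_of_eq h (fun p => ?_) rfl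
    rw [Function.comp_apply, if_pos ⟨p.1 + 1, by ring⟩]
  · rintro ⟨i, j⟩ hx
    refine if_neg fun ⟨k, (hk : i + 1 = k + k)⟩ => hx ⟨(k - 1, j), ?_⟩
    exact Prod.ext (show 2 * (k - 1) + 1 = i by omega) rfl

/-- Sums over the odd first coordinates. -/
theorem hasSum_odd_fst {f : ℕ → ℕ → ℂ} {s : ℂ}
    (h : HasSum (fun p : ℕ × ℕ => f (2 * p.1 + 1) p.2) s) :
    HasSum (fun p : ℕ × ℕ => if Odd (p.1 + 1) then f (p.1 + 1) p.2 else 0) s := by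
  have hinj : Function.Injective fun p : ℕ × ℕ => (2 * p.1, p.2) := by
    rintro ⟨a, b⟩ ⟨c, d⟩ h
    simp only [Prod.mk.injEq] at h ⊢
    omega
  rw [← hinj.hasSum_iff]
  · refine hasSum_of_eq h (fun p => ?_) rfl
    rw [Function.comp_apply, if_pos ⟨p.1, rfl⟩]
  · rintro ⟨i, j⟩ hx
    refine if_neg fun ⟨k, (hk : i + 1 = 2 * k + 1)⟩ => hx ⟨(k, j), ?_⟩
    exact Prod.ext (show 2 * k = i by omega) rfl

/-- The Lambert series identity behind the class number relation. -/
theorem hasSum_lambert_zero (hq : ‖q‖ < 1) :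
    HasSum (fun p : ℕ × ℕ =>
      ((if Odd (p.1 + 1) then (2 * p.2 + 1 : ℂ) * q ^ ((p.1 + 1) * (2 * p.2 + 1)) *
          (1 - q ^ ((p.1 + 1) ^ 2)) else 0) -
        (p.1 + 1 : ℂ) * q ^ ((p.1 + 1) * (2 * p.2 + 1)) *
          (q ^ ((p.1 + 1) ^ 2) - (-1) ^ (p.1 + 1)))) 0 := by
  -- Put x = i+1, y = 2j+1. The summand is (y-x)q^{xy} - (x+y)q^{x(x+y)} for odd x and xq^{xy} -
  -- xq^{x(x+y)} for even x. The antisymmetric part cancels, and `minDiffEquiv` matches all negative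
  -- terms with the series of xq^{xy} over even x.
  have hT : Summable fun p : ℕ × ℕ =>
      ((2 * p.1 + 2 : ℕ) : ℂ) * q ^ ((2 * p.1 + 2) * (2 * p.2 + 1)) :=
    summable_of_lambert_bound hq 2 fun i j =>
      norm_natCast_mul_pow_le hq (by omega) (by nlinarith [Nat.zero_le (i * j)])
  have h1 := minDiffEquiv.hasSum_iff.mpr hT.hasSum
  have h2 := hasSum_even_fst (f := fun x j => (x : ℂ) * q ^ (x * (2 * j + 1))) hT.hasSum
  have hO : Summable fun p : ℕ × ℕ =>
      ((2 * p.2 + 1 : ℕ) : ℂ) * q ^ ((2 * p.1 + 1) * (2 * p.2 + 1)) -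
        ((2 * p.1 + 1 : ℕ) : ℂ) * q ^ ((2 * p.1 + 1) * (2 * p.2 + 1)) :=
    (summable_of_lambert_bound hq 2 fun i j =>
      norm_natCast_mul_pow_le hq (by omega) (by nlinarith [Nat.zero_le (i * j)])).sub
    (summable_of_lambert_bound hq 2 fun i j =>
      norm_natCast_mul_pow_le hq (by omega) (by nlinarith [Nat.zero_le (i * j)]))
  have h3 := hasSum_odd_fst (f := fun x j => ((2 * j + 1 : ℕ) : ℂ) * q ^ (x * (2 * j + 1)) -
      (x : ℂ) * q ^ (x * (2 * j + 1))) (hasSum_zero_of_equiv hO (Equiv.prodComm ℕ ℕ) fun p => by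
    simp only [Equiv.prodComm_apply, Prod.fst_swap, Prod.snd_swap]
    rw [mul_comm (2 * p.2 + 1) (2 * p.1 + 1)]
    ring)
  refine hasSum_of_eq ((h3.add h2).sub h1) (fun p => ?_) (by ring)
  obtain ⟨i, j⟩ := p
  simp only [Function.comp_apply, minDiffEquiv, Equiv.coe_fn_mk]
  rcases Nat.even_or_odd' i with ⟨k, rfl | rfl⟩
  · have ho : Odd (2 * k + 1) := ⟨k, rfl⟩
    rw [if_pos ho, if_pos ho, if_neg (Nat.not_even_iff_odd.mpr ho), if_pos (by omega),
      ho.neg_one_pow, show (2 * k + 2 * j) / 2 = k + j by omega, show 2 * k / 2 = k by omega]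
    push_cast
    ring
  · have he : Even (2 * k + 1 + 1) := ⟨k + 1, by ring⟩
    rw [if_neg (Nat.not_odd_iff_even.mpr he), if_neg (Nat.not_odd_iff_even.mpr he), if_pos he,
      if_neg (by omega), he.neg_one_pow, show (2 * k + 1) / 2 = k by omega,
      show (2 * k + 1 + 1 + 2 * j) / 2 = k + 1 + j by omega]
    push_cast
    ring

theorem hasSum_cosech (hq : ‖q‖ < 1) {x : ℕ} (hx : x ≠ 0) :
    HasSum (fun j : ℕ => q ^ (x * (2 * j + 1))) (cosech q x) := by
  have h : ‖q ^ (2 * x)‖ < 1 := by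
    rw [norm_pow]; exact pow_lt_one₀ (norm_nonneg _) hq (by omega)
  refine hasSum_of_eq ((hasSum_geometric_of_norm_lt_one h).mul_left (q ^ x)) (fun j => ?_) ?_
  · rw [← pow_mul, ← pow_add]; congr 1; ring
  · rw [cosech, div_eq_mul_inv, show (2 * (x : ℤ)) = ((2 * x : ℕ) : ℤ) by push_cast; ring,
      zpow_natCast, zpow_natCast]

theorem hasSum_cotanh_cosech (hq : ‖q‖ < 1) {x : ℕ} (hx : x ≠ 0) :
    HasSum (fun j : ℕ => (2 * j + 1 : ℂ) * q ^ (x * (2 * j + 1))) (cotanh q x * cosech q x) := by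
  have h : ‖q ^ (2 * x)‖ < 1 := by
    rw [norm_pow]; exact pow_lt_one₀ (norm_nonneg _) hq (by omega)
  have h0 : 1 - q ^ (2 * x) ≠ 0 := one_sub_pow_ne_zero hq (by omega)
  refine hasSum_of_eq ((((hasSum_coe_mul_geometric_of_norm_lt_one h).mul_left 2).add
    (hasSum_geometric_of_norm_lt_one h)).mul_left (q ^ x)) (fun j => ?_) ?_
  · rw [show x * (2 * j + 1) = x + 2 * x * j by ring, pow_add, pow_mul q (2 * x)]
    ring
  · rw [cosech, cotanh, show (2 * (x : ℤ)) = ((2 * x : ℕ) : ℤ) by push_cast; ring,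
      zpow_natCast, zpow_natCast]
    field_simp
    ring

/-- The two expressions for the class number relation agree. -/
theorem tsum_relation_eq (hq0 : q ≠ 0) (hq : ‖q‖ < 1) :
    (∑' m : ℤ, if Odd m then (1 - q ^ (m ^ 2)) * (cotanh q m * cosech q m) else 0) =
      ∑' m : ℤ, m * (cosech q m * thetaWeight q m) := by
  let d : ℤ → ℂ := fun m =>
    (if Odd m then (1 - q ^ (m ^ 2)) * (cotanh q m * cosech q m) else 0) -
      m * (cosech q m * thetaWeight q m)
  -- Summing the Lambert identity over j first restores the closed forms. Since d is even and d(0) =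
  -- 0, the positive integers suffice.
  have hnat : HasSum (fun i : ℕ => d ((i + 1 : ℕ) : ℤ)) 0 := by
    refine (hasSum_lambert_zero hq).prod_fiberwise fun i => ?_
    have h1 := (hasSum_cotanh_cosech hq (x := i + 1) (by omega)).mul_right (1 - q ^ ((i + 1) ^ 2))
    have h2 := ((hasSum_cosech hq (x := i + 1) (by omega)).mul_left (i + 1 : ℂ)).mul_right
      (q ^ ((i + 1) ^ 2) - (-1) ^ (i + 1))
    have e1 : q ^ (((i + 1 : ℕ) : ℤ) ^ 2) = q ^ ((i + 1) ^ 2) := by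
      exact_mod_cast zpow_natCast q ((i + 1) ^ 2)
    have e2 : thetaWeight q ((i + 1 : ℕ) : ℤ) = q ^ ((i + 1) ^ 2) - (-1) ^ (i + 1) := by
      rw [thetaWeight, e1, zpow_natCast]
    by_cases ho : Odd (i + 1)
    · have ho' : Odd ((i + 1 : ℕ) : ℤ) := by exact_mod_cast ho
      simp only [d, if_pos ho, if_pos ho', e1, e2]
      refine hasSum_of_eq (h1.sub h2) (fun j => rfl) ?_
      push_cast
      ring
    · have ho' : ¬Odd ((i + 1 : ℕ) : ℤ) := by exact_mod_cast ho
      simp only [d, if_neg ho, if_neg ho', e1, e2]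
      refine hasSum_of_eq h2.neg (fun j => by ring) ?_
      push_cast
      ring
  have hd0 : d 0 = 0 := by simp [d]
  have hnat' : HasSum (fun i : ℕ => d i) 0 := by
    have := (hasSum_nat_add_iff (f := fun i : ℕ => d i) 1).mp hnat
    simpa [hd0] using this
  have hneg : ∀ m, d (-m) = d m := by
    intro m
    simp only [d]
    rw [if_congr odd_neg rfl rfl, neg_sq, cotanh_neg hq0, cosech_neg hq0, thetaWeight_neg]
    rw [Int.cast_neg, neg_mul_neg, neg_mul, neg_mul, mul_neg, neg_neg]
  have hint : HasSum d 0 := by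
    have := HasSum.of_nat_of_neg hnat' (by simpa only [hneg] using hnat')
    simpa [hd0] using this
  have hs := summable_int_mul_thetaWeight hq0 hq
  have h1 := (hint.add hs.hasSum).tsum_eq
  simpa [d] using h1

end

/-! ### The generating function of the triples -/

/-- The exponent `n` with `PQ + QR + RP = 4n - 1`. -/
def tripleIndex (t : ℕ × ℕ × ℕ) : ℕ :=
  t.1 * t.2.1 + t.2.1 * t.2.2 + t.2.2 * t.1 + t.1 + t.2.1 + t.2.2 + 1

theorem mem_evenTriples {n : ℕ} {t : ℕ × ℕ × ℕ} :
    t ∈ evenTriples n ↔ tripleIndex t = n ∧ t.1 % 2 = t.2.1 % 2 := by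
  rw [evenTriples, mem_filter, mem_tripleSet]
  rfl

/-- The term of the signed generating function of the triples with `a ≡ b (mod 2)`. -/
def tripleTerm (q : ℂ) (t : ℕ × ℕ × ℕ) : ℂ :=
  if t.1 % 2 = t.2.1 % 2 then (-1) ^ (t.1 + t.2.2) * q ^ tripleIndex t else 0

theorem neg_one_pow_eq_neg {a b : ℕ} (h : Odd (a + b)) : (-1 : ℂ) ^ a = -(-1) ^ b := by
  have h1 : (-1 : ℂ) ^ (a + b) = -1 := h.neg_one_pow
  rw [pow_add] at h1
  have h2 : ((-1 : ℂ) ^ b) * (-1) ^ b = 1 := by rw [← mul_pow]; simp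
  linear_combination (-1 : ℂ) ^ b * h1 - (-1 : ℂ) ^ a * h2

/-- For a ≡ b mod 2 the index has the parity of a+k+1, so all signs become -1. -/
theorem tripleTerm_neg (q : ℂ) (t : ℕ × ℕ × ℕ) :
    tripleTerm (-q) t = -if t.1 % 2 = t.2.1 % 2 then q ^ tripleIndex t else 0 := by
  obtain ⟨a, b, k⟩ := t
  rw [tripleTerm]
  split_ifs with h
  · have ho : Odd (a + k + tripleIndex (a, b, k)) := by
      rw [Nat.odd_iff, tripleIndex]
      simp only at h ⊢
      rcases Nat.mod_two_eq_zero_or_one a with ha | ha <;>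
      rcases Nat.mod_two_eq_zero_or_one k with hk | hk <;>
      simp [Nat.add_mod, Nat.mul_mod, ← h, ha, hk]
    rw [neg_pow q, neg_one_pow_eq_neg ho]
    have h2 : ((-1 : ℂ) ^ tripleIndex (a, b, k)) * (-1) ^ tripleIndex (a, b, k) = 1 := by
      rw [← mul_pow]; simp
    linear_combination -q ^ tripleIndex (a, b, k) * h2
  · simp

theorem summable_tripleTerm {q : ℂ} (hq : ‖q‖ < 1) : Summable (tripleTerm q) := by
  have h0 : Summable fun n : ℕ => ‖q‖ ^ n := summable_geometric_of_lt_one (norm_nonneg q) hq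
  have z0 : 0 ≤ fun n : ℕ => ‖q‖ ^ n := fun n => by positivity
  have h1 := h0.mul_of_nonneg h0 z0 z0
  have h2 := h0.mul_of_nonneg h1 z0 fun x => by positivity
  refine Summable.of_norm_bounded h2 fun t => ?_
  obtain ⟨a, b, k⟩ := t
  rw [tripleTerm]
  split_ifs
  · rw [norm_mul, norm_pow, norm_neg, norm_one, one_pow, one_mul, norm_pow, ← pow_add, ← pow_add]
    refine pow_le_pow_of_le_one (norm_nonneg _) hq.le ?_
    simp only [tripleIndex]
    have h1 := Nat.zero_le (a * b)
    have h2 := Nat.zero_le (b * k)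
    have h3 := Nat.zero_le (k * a)
    omega
  · rw [norm_zero]; positivity

/-- Regrouping of a sum along a map to the naturals with essentially finite fibres. -/
theorem hasSum_fiberwise {ι : Type*} {f : ι → ℂ} {a : ℂ} (h : HasSum f a) (N : ι → ℕ)
    (s : ℕ → Finset ι) (hs : ∀ n, ∀ t ∈ s n, N t = n) (hf : ∀ t, t ∉ s (N t) → f t = 0) :
    HasSum (fun n => ∑ t ∈ s n, f t) a := by
  refine ((Equiv.sigmaFiberEquiv N).hasSum_iff.mpr h).sigma fun n => ?_
  have h2 : HasSum ({t | N t = n}.indicator f) (∑ t ∈ s n, f t) := by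
    rw [Finset.sum_congr rfl fun t ht =>
      (Set.indicator_of_mem (show t ∈ {t | N t = n} from hs n t ht) f).symm]
    refine hasSum_sum_of_ne_finset_zero fun t ht => ?_
    rw [Set.indicator_apply]
    split_ifs with h4
    · obtain rfl : N t = n := h4
      exact hf t ht
    · rfl
  exact hasSum_subtype_iff_indicator.mpr h2

/-- The series `𝓕_{4,-1}` enumerates the triples with `a ≡ b (mod 2)`. -/
theorem hasSum_termF4 {q G : ℂ} (hG : HasSum (tripleTerm (-q)) G) : HasSum (termF4 q) (-G) := by
  have h1 := hasSum_fiberwise (f := fun t => -tripleTerm (-q) t) hG.neg tripleIndex evenTriples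
    (fun n t ht => (mem_evenTriples.mp ht).1) (fun t ht => by
      rw [tripleTerm_neg, neg_neg, if_neg fun h => ht (mem_evenTriples.mpr ⟨rfl, h⟩)])
  refine hasSum_of_eq h1 (fun n => ?_) rfl
  rw [Finset.sum_congr rfl (g := fun _ => q ^ n)]
  · rw [sum_const, nsmul_eq_mul, termF4]
    congr 1
    rcases Nat.eq_zero_or_pos n with rfl | hn
    · simp [kroneckerF, evenTriples, tripleSet]
    · rw [kroneckerF_eq_card hn, Rat.cast_natCast]
  · intro t ht
    obtain ⟨h4, h5⟩ := mem_evenTriples.mp ht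
    rw [tripleTerm_neg, neg_neg, if_pos h5, h4]

section

variable {q : ℂ}

theorem hasSum_cotanh (hq : ‖q‖ < 1) {n : ℕ} (hn : n ≠ 0) :
    HasSum (fun d : ℤ => (q ^ (2 * n)) ^ d.natAbs) (cotanh q n) := by
  have h : ‖q ^ (2 * n)‖ < 1 := by
    rw [norm_pow]; exact pow_lt_one₀ (norm_nonneg _) hq (by omega)
  have h0 : 1 - q ^ (2 * n) ≠ 0 := one_sub_pow_ne_zero hq (by omega)
  have hg := hasSum_geometric_of_norm_lt_one h
  have h1 := HasSum.of_nat_of_neg (f := fun d : ℤ => (q ^ (2 * n)) ^ d.natAbs)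
    (by simpa using hg) (by simpa using hg)
  refine hasSum_of_eq h1 (fun _ => rfl) ?_
  rw [cotanh, show (2 * (n : ℤ)) = ((2 * n : ℕ) : ℤ) by push_cast; ring, zpow_natCast,
    Int.natAbs_zero, pow_zero]
  field_simp
  ring

/-- Triples with `a ≡ b (mod 2)` in terms of `k`, `min a b` and half the difference. -/
def tripleParam (x : (ℕ × ℕ) × ℤ) : ℕ × ℕ × ℕ :=
  (x.1.2 + 2 * x.2.toNat, x.1.2 + 2 * (-x.2).toNat, x.1.1)

theorem tripleParam_injective : Function.Injective tripleParam := by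
  rintro ⟨⟨k, u⟩, d⟩ ⟨⟨k', u'⟩, d'⟩ h
  simp only [tripleParam, Prod.mk.injEq] at h ⊢
  omega

theorem mem_range_tripleParam {t : ℕ × ℕ × ℕ} (h : t.1 % 2 = t.2.1 % 2) :
    t ∈ Set.range tripleParam := by
  obtain ⟨a, b, k⟩ := t
  have h' : a % 2 = b % 2 := h
  rcases le_total a b with hab | hab
  · refine ⟨((k, a), -(((b - a) / 2 : ℕ) : ℤ)), Prod.ext ?_ (Prod.ext ?_ rfl)⟩
    · simp only [tripleParam]
      omega
    · simp only [tripleParam]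
      omega
  · refine ⟨((k, b), (((a - b) / 2 : ℕ) : ℤ)), Prod.ext ?_ (Prod.ext ?_ rfl)⟩
    · simp only [tripleParam]
      omega
    · simp only [tripleParam]
      omega

/-- With n = k+u+1 the index is n² - k(k+1) + 2n|d|, so the sum over d is a geometric series with
value cotanh(n). -/
theorem tripleTerm_param (hq0 : q ≠ 0) (k u : ℕ) (d : ℤ) :
    tripleTerm q (tripleParam ((k, u), d)) =
      (-1) ^ (k + u) * (q ^ (((k + u + 1 : ℕ) : ℤ) ^ 2) * q ^ (-((k : ℤ) * (k + 1)))) *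
        (q ^ (2 * (k + u + 1))) ^ d.natAbs := by
  have hpar : (tripleParam ((k, u), d)).1 % 2 = (tripleParam ((k, u), d)).2.1 % 2 := by
    simp only [tripleParam]; omega
  have hsign : ((-1 : ℂ)) ^ ((tripleParam ((k, u), d)).1 + (tripleParam ((k, u), d)).2.2) =
      (-1) ^ (k + u) := by
    simp only [tripleParam]
    rw [show u + 2 * d.toNat + k = k + u + 2 * d.toNat by ring, pow_add, pow_mul (-1 : ℂ) 2]
    simp
  have hindex : ((tripleIndex (tripleParam ((k, u), d)) : ℕ) : ℤ) =
      ((k + u + 1 : ℕ) : ℤ) ^ 2 + -((k : ℤ) * (k + 1)) + ((2 * (k + u + 1) * d.natAbs : ℕ) : ℤ) := by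
    simp only [tripleIndex, tripleParam]
    obtain ⟨e, rfl | rfl⟩ := d.eq_nat_or_neg
    · simp only [Int.toNat_natCast, Int.toNat_neg_natCast, Int.natAbs_natCast]
      push_cast
      ring
    · simp only [Int.toNat_natCast, Int.toNat_neg_natCast, Int.natAbs_natCast, neg_neg,
        Int.natAbs_neg]
      push_cast
      ring
  rw [tripleTerm, if_pos hpar, hsign, mul_assoc, ← pow_mul,
    ← zpow_natCast q (tripleIndex _), hindex, zpow_add₀ hq0, zpow_add₀ hq0, zpow_natCast]

theorem hasSum_tripleTerm_regroup (hq0 : q ≠ 0) (hq : ‖q‖ < 1) {G : ℂ}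
    (hG : HasSum (tripleTerm q) G) :
    HasSum (fun n : ℕ => (-1) ^ n * (q ^ (((n + 1 : ℕ) : ℤ) ^ 2) *
      ∑ k ∈ range (n + 1), q ^ (-((k : ℤ) * (k + 1)))) * cotanh q (n + 1 : ℕ)) G := by
  have h1 : HasSum (tripleTerm q ∘ tripleParam) G := by
    refine (tripleParam_injective.hasSum_iff fun t ht => ?_).mpr hG
    exact if_neg fun h => ht (mem_range_tripleParam h)
  have h2 : HasSum (fun x : ℕ × ℕ => (-1) ^ (x.1 + x.2) * (q ^ (((x.1 + x.2 + 1 : ℕ) : ℤ) ^ 2) *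
      q ^ (-((x.1 : ℤ) * (x.1 + 1)))) * cotanh q (x.1 + x.2 + 1 : ℕ)) G := by
    refine h1.prod_fiberwise fun x => ?_
    exact hasSum_of_eq ((hasSum_cotanh hq (n := x.1 + x.2 + 1) (by omega)).mul_left _)
      (fun d => tripleTerm_param hq0 x.1 x.2 d) rfl
  refine hasSum_of_eq (hasSum_fiberwise h2 (fun x => x.1 + x.2) (fun n => antidiagonal n)
    (fun n x hx => mem_antidiagonal.mp hx) fun x hx => absurd (mem_antidiagonal.mpr rfl) hx)
    (fun n => ?_) rfl
  rw [Finset.Nat.sum_antidiagonal_eq_sum_range_succ_mk, mul_sum, mul_sum, sum_mul]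
  refine Finset.sum_congr rfl fun k hk => ?_
  have hk' := mem_range.mp hk
  simp only [show k + (n - k) = n by omega]

/-! ### The Hecke–Rogers series -/

/-- The term of the Hecke–Rogers series, extended by zero. -/
noncomputable def heckeTerm (q : ℂ) (p : ℕ × ℕ) : ℂ :=
  {p : ℕ × ℕ | 1 ≤ p.2 ∧ p.2 ≤ p.1}.indicator
    (fun p => (p.1 : ℂ) * q ^ (p.1 ^ 2 - p.2 * (p.2 - 1) / 2)) p

/-- This makes the truncated subtraction in the exponent exact and leaves geometric decay in both n
and j. -/
theorem hecke_exponent {n j : ℕ} (h1 : 1 ≤ j) (h2 : j ≤ n) :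
    j * (j - 1) / 2 + (n + (j - 1)) ≤ n ^ 2 := by
  obtain ⟨i, rfl⟩ := Nat.exists_eq_add_of_le' h1
  obtain ⟨l, rfl⟩ := Nat.exists_eq_add_of_le' h2
  have h3 : (i + 1) * (i + 1 - 1) / 2 * 2 ≤ (i + 1) * (i + 1 - 1) := Nat.div_mul_le_self _ _
  rw [Nat.add_sub_cancel] at *
  nlinarith [Nat.zero_le (l * i), Nat.zero_le (l * l), show i ≤ i * i by
    rcases i with _ | i <;> nlinarith, show l ≤ l * l by rcases l with _ | l <;> nlinarith]

theorem summable_heckeTerm (hq : ‖q‖ < 1) : Summable (heckeTerm q) := by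
  have h0 : Summable fun n : ℕ => ‖q‖ ^ (n - 1) := by
    rw [← summable_nat_add_iff 1]
    simpa using summable_geometric_of_lt_one (norm_nonneg q) hq
  have h1 : Summable fun n : ℕ => (n : ℝ) * ‖q‖ ^ n := by
    simpa using summable_pow_mul_geometric_of_norm_lt_one 1 (r := ‖q‖) (by rwa [norm_norm])
  refine Summable.of_norm_bounded (h1.mul_of_nonneg h0 (fun n => by positivity)
    fun n => by positivity) fun p => ?_
  rw [heckeTerm, Set.indicator_apply]
  split_ifs with hp
  · rw [norm_mul, Complex.norm_natCast, norm_pow, mul_assoc, ← pow_add]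
    have h2 := hecke_exponent hp.1 hp.2
    have h3 := pow_le_pow_of_le_one (norm_nonneg q) hq.le
      (show p.1 + (p.2 - 1) ≤ p.1 ^ 2 - p.2 * (p.2 - 1) / 2 by omega)
    gcongr
  · rw [norm_zero]; positivity

theorem hasSum_heckeTerm_rows (hq0 : q ≠ 0) {R : ℂ} (hR : HasSum (heckeTerm q) R) :
    HasSum (fun n : ℕ => n * (q ^ ((n : ℤ) ^ 2) * ∑ j ∈ range n, q ^ (-tri j))) R := by
  refine hR.prod_fiberwise fun n => ?_
  have h1 : (n : ℂ) * (q ^ ((n : ℤ) ^ 2) * ∑ j ∈ range n, q ^ (-tri j)) =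
      ∑ j ∈ Ico 1 (n + 1), heckeTerm q (n, j) := by
    rw [Finset.sum_Ico_eq_sum_range, Nat.add_sub_cancel, mul_sum, mul_sum]
    refine Finset.sum_congr rfl fun i hi => ?_
    have hi' := mem_range.mp hi
    have h2 := hecke_exponent (n := n) (j := 1 + i) (by omega) (by omega)
    rw [heckeTerm, Set.indicator_of_mem (by constructor <;> simp only <;> omega),
      ← zpow_natCast, ← zpow_add₀ hq0, Nat.cast_sub ((Nat.le_add_right _ _).trans h2),
      add_comm 1 i, Nat.add_sub_cancel, mul_comm (i + 1) i, tri_natCast]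
    push_cast
    rfl
  rw [h1]
  refine hasSum_sum_of_ne_finset_zero fun j hj => Set.indicator_of_notMem (fun h => hj ?_) _
  rw [mem_Ico]
  exact ⟨h.1, Nat.lt_succ_of_le h.2⟩

theorem hecke_rogers (hq0 : q ≠ 0) (hq : ‖q‖ < 1) {ψ : ℂ} (hψ0 : ψ ≠ 0)
    (hψ : HasSum (fun s : ℕ => q ^ (s * (s + 1) / 2)) ψ) :
    HasSum (heckeTerm q) (ψ * ∑' t, tripleTerm q t) := by
  have hR := (summable_heckeTerm hq).hasSum
  have hG := (summable_tripleTerm hq).hasSum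
  have hφ := (summable_norm_sq hq0 hq).of_norm.hasSum
  have hψ₂ : HasSum (fun s : ℕ => q ^ (s * (s + 1))) (∑' s : ℕ, q ^ (s * (s + 1))) := by
    refine (Summable.of_norm_bounded (summable_geometric_of_lt_one (norm_nonneg q) hq)
      fun s => ?_).hasSum
    rw [norm_pow]
    exact pow_le_pow_of_le_one (norm_nonneg _) hq.le (by nlinarith)
  have h1 := hasSum_nat_mul_triangular hq0 hq hψ hφ
  have h2 := hasSum_kronecker_relation hq0 hq (hasSum_oblong_expansion hq0 hq hψ₂)
  rw [tsum_relation_eq hq0 hq] at h2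
  have h3 : HasSum (fun n : ℕ => 2 * (n * (ψ * (q ^ ((n : ℤ) ^ 2) * ∑ j ∈ range n, q ^ (-tri j)))))
      (2 * ψ * ∑' p, heckeTerm q p) :=
    hasSum_of_eq ((hasSum_heckeTerm_rows hq0 hR).mul_left (2 * ψ)) (fun n => by ring) rfl
  -- The term n = 0 vanishes because `cotanh` is 0 there; the shift matches the regrouped series,
  -- which starts at n = 1.
  have h4 := (hasSum_nat_add_iff' 1).mpr h2
  rw [Finset.sum_range_one, Nat.cast_zero, cotanh_zero] at h4
  have h5 := hasSum_of_eq ((hasSum_tripleTerm_regroup hq0 hq hG).mul_left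
    (2 * ∑' s : ℕ, q ^ (s * (s + 1))))
    (g := fun n : ℕ => 2 * ((-1) ^ (n + 1 + 1) * cotanh q (n + 1 : ℕ) *
      ((∑' s : ℕ, q ^ (s * (s + 1))) * (q ^ (((n + 1 : ℕ) : ℤ) ^ 2) *
        ∑ k ∈ range (n + 1), q ^ (-((k : ℤ) * (k + 1)))))))
    (fun n => by rw [pow_add, pow_add]; ring) rfl
  have e1 := h3.unique h1
  have e2 := h5.unique h4
  have e3 := psi_sq_eq hq0 hψ hψ₂ hφ
  have key : ∑' p, heckeTerm q p = ψ * ∑' t, tripleTerm q t := by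
    refine mul_left_cancel₀ (mul_ne_zero two_ne_zero hψ0) ?_
    linear_combination e1 - (∑' m : ℤ, q ^ (m ^ 2)) * e2 - 2 * (∑' t, tripleTerm q t) * e3
  rw [← key]
  exact hR

end

end HurwitzSeries

theorem mainTheorem10 (q : ℂ) (hq : ‖q‖ < 1) :
    (∀ k : ℕ, 1 ≤ k → Multipliable (fun i : ℕ => 1 - q ^ k * (q ^ k) ^ i)) ∧
    HurwitzSeries.J 2 q ≠ 0 ∧
    Summable (HurwitzSeries.termF4 q) ∧
    HasSum
      (fun p : {p : ℕ × ℕ // 1 ≤ p.2 ∧ p.2 ≤ p.1} =>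
        (-1 : ℂ) ^ (p.1.1 - 1 + p.1.2 * (p.1.2 - 1) / 2) * (p.1.1 : ℂ) *
          q ^ (p.1.1 ^ 2 - p.1.2 * (p.1.2 - 1) / 2))
      (HurwitzSeries.J 1 q * HurwitzSeries.J 4 q / HurwitzSeries.J 2 q *
        HurwitzSeries.seriesF4 q) := by
  have hq' : ‖-q‖ < 1 := by rwa [norm_neg]
  have hF := HurwitzSeries.hasSum_termF4 (HurwitzSeries.summable_tripleTerm hq').hasSum
  refine ⟨fun k hk => HurwitzSeries.multipliable_J hq (by omega),
    HurwitzSeries.J_ne_zero hq two_ne_zero, hF.summable, ?_⟩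
  have hexp : ∀ p : {p : ℕ × ℕ // 1 ≤ p.2 ∧ p.2 ≤ p.1},
      p.1.2 * (p.1.2 - 1) / 2 + (p.1.1 + (p.1.2 - 1)) ≤ p.1.1 ^ 2 :=
    fun p => HurwitzSeries.hecke_exponent p.2.1 p.2.2
  -- Integer powers of q require q ≠ 0; at q = 0 both sides vanish since every exponent is positive
  -- and F(-1) = 0.
  rcases eq_or_ne q 0 with rfl | hq0
  · have h0 : HurwitzSeries.seriesF4 0 = 0 := by
      rw [HurwitzSeries.seriesF4, tsum_eq_single 0]
      · simp [HurwitzSeries.termF4, HurwitzSeries.kroneckerF]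
      · intro n hn
        simp [HurwitzSeries.termF4, hn]
    rw [h0, mul_zero]
    refine HurwitzSeries.hasSum_of_eq hasSum_zero (fun p => ?_) rfl
    have h1 := hexp p
    have h2 := p.2.1
    have h3 := p.2.2
    rw [zero_pow (by omega), mul_zero]
  · have hL0 : HurwitzSeries.J 1 q * HurwitzSeries.J 4 q / HurwitzSeries.J 2 q ≠ 0 :=
      div_ne_zero (mul_ne_zero (HurwitzSeries.J_ne_zero hq one_ne_zero)
        (HurwitzSeries.J_ne_zero hq four_ne_zero)) (HurwitzSeries.J_ne_zero hq two_ne_zero)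
    have hψ := HurwitzSeries.hasSum_triangular hq' (HurwitzSeries.tendsto_gaussProd hq) hL0
    have hR := HurwitzSeries.hecke_rogers (neg_ne_zero.mpr hq0) hq' hL0 hψ
    have hR' := (hasSum_subtype_iff_indicator (s := {p : ℕ × ℕ | 1 ≤ p.2 ∧ p.2 ≤ p.1})).mpr hR
    refine HurwitzSeries.hasSum_of_eq hR'.neg (fun p => ?_) ?_
    · have h1 := hexp p
      have h2 := p.2.1
      have h3 := p.2.2
      -- The sign exponent and the exponent of q add up to n-1+n², which is odd; so the stated sign
      -- is minus the one produced by `-q`.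
      have ho : Odd (p.1.1 - 1 + p.1.2 * (p.1.2 - 1) / 2 +
          (p.1.1 ^ 2 - p.1.2 * (p.1.2 - 1) / 2)) := by
        obtain ⟨n, hn⟩ := Nat.exists_eq_add_of_le' (h2.trans h3)
        rw [show p.1.1 - 1 + p.1.2 * (p.1.2 - 1) / 2 +
          (p.1.1 ^ 2 - p.1.2 * (p.1.2 - 1) / 2) = p.1.1 - 1 + p.1.1 ^ 2 by omega, hn,
          Nat.add_sub_cancel]
        obtain ⟨l, hl⟩ := Nat.even_mul_succ_self n
        exact ⟨l + n, by nlinarith⟩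
      rw [Function.comp_apply, HurwitzSeries.neg_one_pow_eq_neg ho, neg_pow q]
      ring
    · rw [HurwitzSeries.seriesF4, hF.tsum_eq]
      ring
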